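/- Let $n\ge 2$ and let $$W_8=\{x\in\mathbb R^{2n} : x_1^2+x_3^3=x_2^2+x_1x_3=x_{\ge 4}=0\}.$$ All functions, forms and vector fields below are $C^\infty$ germs at $0\in\mathbb R^{2n}$. For $k\ge 1$, two $k$-forms $\omega,\tilde\omega$ have the same algebraic restriction to $W_8$, written $[\omega]=[\tilde\omega]$, if $\omega-\tilde\omega=\alpha+d\beta$ for some $k$-form $\alpha$ and some $(k-1)$-form $\beta$ which vanish at every point of $W_8$ near $0$. Consider the closed $2$-forms $$\theta_1=dx_2\wedge dx_3,\quad \theta_2=dx_1\wedge dx_3,\quad \theta_3=dx_1\wedge dx_2,\quad \theta_4=x_3\,dx_2\wedge dx_3,\quad \theta_5=x_2\,dx_2\wedge dx_3,$$ $$\theta_6=x_1\,dx_2\wedge dx_3+x_2\,dx_1\wedge dx_3,\quad \theta_7=x_3^2\,dx_2\wedge dx_3,\quad \theta_8=x_2^2\,dx_2\wedge dx_3,$$ the Euler vector field $E=6x_1\partial_{x_1}+5x_2\partial_{x_2}+4x_3\partial_{x_3}$, and the vector fields $$X_0=E,\ X_1=x_3E,\ X_2=x_2E,\ X_3=x_1E,\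 X_4=x_3^2E,\ X_5=x_2x_3E,\ X_6=x_2^2E,\ X_7=x_1x_3E.$$ Then $[\theta_1],\dots,[\theta_8]$ form a basis of the vector space of algebraic restrictions to $W_8$ of closed $2$-forms. Each $X_i$ is tangent to $W_8$ (the derivative along $X_i$ of any function vanishing on $W_8$ vanishes on $W_8$), the Lie derivative along $X_i$ induces a well-defined linear map $\mathcal L_{X_i}[\omega]=[\mathcal L_{X_i}\omega]$ on algebraic restrictions of $2$-forms to $W_8$, and this infinitesimal action on the basis is given by the following table, whose entry in the row of $X_i$ and the column of $[\theta_j]$ is $\mathcal L_{X_i}[\theta_j]$: $$\begin{array}{l|rrrrrrrr} & [\theta_1] & [\theta_2] & [\theta_3] & [\theta_4] & [\theta_5] & [\theta_6] & [\theta_7] & [\theta_8]\\ \hline X_0=E & 9[\theta_1] & 10[\theta_2] & 11[\theta_3] & 13[\theta_4] & 14[\theta_5] & 15[\theta_6] & 17[\theta_7] & 19[\theta_8]\\ X_1=x_3E & 13[\theta_4] & -28[\theta_5] & 5[\theta_6] & 17[\theta_7] & 0 & -57[\theta_8] & 0 & 0\\ X_2=x_2E & 14[\theta_5] & 10[\theta_6]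 & 0 & 0 & 19[\theta_8] & 0 & 0 & 0\\ X_3=x_1E & 5[\theta_6] & 0 & \tfrac{51}{2}[\theta_7] & -19[\theta_8] & 0 & 0 & 0 & 0\\ X_4=x_3^2E & 17[\theta_7] & 0 & -19[\theta_8] & 0 & 0 & 0 & 0 & 0\\ X_5=x_2x_3E & 0 & -38[\theta_8] & 0 & 0 & 0 & 0 & 0 & 0\\ X_6=x_2^2E & 19[\theta_8] & 0 & 0 & 0 & 0 & 0 & 0 & 0\\ X_7=x_1x_3E & -19[\theta_8] & 0 & 0 & 0 & 0 & 0 & 0 & 0 \end{array}$$ -/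

import Mathlib

open Filter Topology
open scoped ContDiff

noncomputable section

namespace AlgRestrW8

/-! ### Germs at `0` of smooth differential forms on `E`

A germ at `0` is represented by a map defined on the whole space of which only the values near `0`
matter; every condition below is imposed on some neighbourhood of `0` only, and representatives
that agree near `0` have the same algebraic restriction. -/

/-- Fields of alternating `k`-forms on `E`. -/
abbrev FormField (E : Type) [NormedAddCommGroup E] [NormedSpace ℝ E] (k : ℕ) : Type :=
  E → E [⋀^Fin k]→L[ℝ] ℝ

/-- `f` is smooth (of class `C^∞`) on a neighbourhood of `0`. -/
def SmoothNearZero {E : Type} [NormedAddCommGroup E] [NormedSpace ℝ E]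
    {F : Type} [NormedAddCommGroup F] [NormedSpace ℝ F]
    (f : E → F) : Prop :=
  ∀ᶠ x in 𝓝 (0 : E), ContDiffAt ℝ ∞ f x

/-- `f` vanishes at every point, close enough to `0`, of the set `N`. -/
def VanishesOn {E : Type} [NormedAddCommGroup E] [NormedSpace ℝ E]
    {F : Type} [NormedAddCommGroup F] [NormedSpace ℝ F]
    (N : Set E) (f : E → F) : Prop :=
  ∀ᶠ x in 𝓝 (0 : E), x ∈ N → f x = 0

/-- The space `Λ^k` of (representatives of) germs at `0` of smooth `k`-forms on `E`. -/
def smoothForms (E : Type) [NormedAddCommGroup E] [NormedSpace ℝ E] (k : ℕ) :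
    @Submodule ℝ (FormField E k) _ AddCommGroup.toAddCommMonoid inferInstance where
  carrier := {η | SmoothNearZero η}
  add_mem' := fun ha hb => by
    filter_upwards [ha, hb] with x h1 h2 using h1.add h2
  zero_mem' := Eventually.of_forall fun _ => contDiffAt_const
  smul_mem' := fun c _ ha => by
    filter_upwards [ha] with x h1 using contDiffAt_const.smul h1

theorem extDeriv_contDiffAt {E : Type} [NormedAddCommGroup E] [NormedSpace ℝ E]
    {k : ℕ} {η : FormField E k} {x : E}
    (h : ContDiffAt ℝ ∞ η x) : ContDiffAt ℝ ∞ (extDeriv η) x := by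
  have hc : ContDiff ℝ ∞
      (ContinuousAlternatingMap.alternatizeUncurryFinCLM ℝ E ℝ (n := k)) := by fun_prop
  exact hc.contDiffAt.comp x (h.fderiv_right (m := ∞) le_rfl)

/-- Germs at `0` of closed smooth `k`-forms. -/
def closedForms (E : Type) [NormedAddCommGroup E] [NormedSpace ℝ E] (k : ℕ) :
    Submodule ℝ (smoothForms E k) where
  carrier := {η | ∀ᶠ x in 𝓝 (0 : E), extDeriv η.1 x = 0}
  add_mem' := fun {a b} ha hb => by
    have hsa : SmoothNearZero a.1 := a.2
    have hsb : SmoothNearZero b.1 := b.2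
    filter_upwards [ha, hb, hsa, hsb] with x h1 h2 h3 h4
    have h := extDeriv_add (h3.differentiableAt (by simp)) (h4.differentiableAt (by simp))
    simpa [h1, h2] using h
  zero_mem' := Eventually.of_forall fun x => by
    have h := extDeriv_smul (x := x) (0 : ℝ) (0 : FormField E k)
    simpa using h
  smul_mem' := fun c a ha => by
    filter_upwards [ha] with x h1
    have h := extDeriv_smul (x := x) c a.1
    simpa [h1] using h

/-! ### Algebraic restrictions -/

/-- The space `𝒜_0^{k+1}(N)` of germs of `(k+1)`-forms with zero algebraic restriction to `N`:
the germs of `α + dβ` with `α` a `(k+1)`-form and `β` a `k`-form, both vanishing at all points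
of `N`. -/
def zeroRestriction {E : Type} [NormedAddCommGroup E] [NormedSpace ℝ E] (N : Set E) (k : ℕ) :
    Submodule ℝ (smoothForms E (k + 1)) where
  carrier := {η | ∃ (α : FormField E (k + 1)) (β : FormField E k),
    SmoothNearZero α ∧ SmoothNearZero β ∧ VanishesOn N α ∧ VanishesOn N β ∧
      ∀ᶠ x in 𝓝 (0 : E), η.1 x = α x + extDeriv β x}
  add_mem' := by
    rintro a b ⟨α, β, h1, h2, h3, h4, h5⟩ ⟨α', β', h1', h2', h3', h4', h5'⟩
    refine ⟨α + α', β + β', ?_, ?_, ?_, ?_, ?_⟩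
    · filter_upwards [h1, h1'] with x u v using u.add v
    · filter_upwards [h2, h2'] with x u v using u.add v
    · filter_upwards [h3, h3'] with x u v hx
      simp [u hx, v hx]
    · filter_upwards [h4, h4'] with x u v hx
      simp [u hx, v hx]
    · filter_upwards [h2, h2', h5, h5'] with x u v p q
      rw [extDeriv_add (u.differentiableAt (by simp)) (v.differentiableAt (by simp))]
      simp only [Submodule.coe_add, Pi.add_apply, p, q]
      abel
  zero_mem' := by
    refine ⟨0, 0, Eventually.of_forall fun _ => contDiffAt_const,
      Eventually.of_forall fun _ => contDiffAt_const,
      Eventually.of_forall fun _ _ => rfl, Eventually.of_forall fun _ _ => rfl,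
      Eventually.of_forall fun x => ?_⟩
    have h := extDeriv_smul (x := x) (0 : ℝ) (0 : FormField E k)
    rw [zero_smul, zero_smul] at h
    rw [h]
    simp
  smul_mem' := by
    rintro c a ⟨α, β, h1, h2, h3, h4, h5⟩
    refine ⟨c • α, c • β, ?_, ?_, ?_, ?_, ?_⟩
    · filter_upwards [h1] with x u using contDiffAt_const.smul u
    · filter_upwards [h2] with x u using contDiffAt_const.smul u
    · filter_upwards [h3] with x u hx
      simp [u hx]
    · filter_upwards [h4] with x u hx
      simp [u hx]
    · filter_upwards [h5] with x p
      rw [extDeriv_smul]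
      simp [p]

/-- The space `[Λ^{k+1}(E)]_N` of algebraic restrictions to `N` of germs of
`(k+1)`-forms. -/
abbrev AlgRestriction {E : Type} [NormedAddCommGroup E] [NormedSpace ℝ E]
    (N : Set E) (k : ℕ) : Type :=
  smoothForms E (k + 1) ⧸ zeroRestriction N k

/-- The algebraic restriction `[η]_N` of a germ of a `(k+1)`-form. -/
abbrev algRestriction {E : Type} [NormedAddCommGroup E] [NormedSpace ℝ E]
    (N : Set E) {k : ℕ} (η : smoothForms E (k + 1)) :
    AlgRestriction N k :=
  (zeroRestriction N k).mkQ η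

/-- The space `[Z^{k+1}(E)]_N` of algebraic restrictions to `N` of germs of closed
`(k+1)`-forms. -/
def closedRestrictions {E : Type} [NormedAddCommGroup E] [NormedSpace ℝ E]
    (N : Set E) (k : ℕ) : Submodule ℝ (AlgRestriction N k) :=
  (closedForms E (k + 1)).map (zeroRestriction N k).mkQ

/-! ### Vector fields -/

/-- Germs at `0` of smooth vector fields on `E`. -/
abbrev SmoothVectorField (E : Type) [NormedAddCommGroup E] [NormedSpace ℝ E]
    : Type := {X : E → E // SmoothNearZero X}

/-- The vector field `X` is tangent to `N`: the derivative along `X` of every smooth function germ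
vanishing on `N` vanishes on `N`. -/
def IsTangentTo {E : Type} [NormedAddCommGroup E] [NormedSpace ℝ E]
    (X : SmoothVectorField E) (N : Set E) : Prop :=
  ∀ f : E → ℝ, SmoothNearZero f → VanishesOn N f →
    VanishesOn N (fun x => fderiv ℝ f x (X.1 x))

/-- The interior product `ι_X η`. -/
def interiorProd {E : Type} [NormedAddCommGroup E] [NormedSpace ℝ E]
    {k : ℕ} (X : E → E) (η : FormField E (k + 1)) : FormField E k :=
  fun x => (η x).curryLeft (X x)

theorem interiorProd_contDiffAt {E : Type} [NormedAddCommGroup E] [NormedSpace ℝ E]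
    {k : ℕ} {X : E → E} {η : FormField E (k + 1)}
    {x : E} (hX : ContDiffAt ℝ ∞ X x) (hη : ContDiffAt ℝ ∞ η x) :
    ContDiffAt ℝ ∞ (interiorProd X η) x := by
  have hc : ContDiff ℝ ∞
      (ContinuousAlternatingMap.curryLeft (𝕜 := ℝ) (E := E) (F := ℝ) (n := k)) := by
    apply IsBoundedLinearMap.contDiff
    exact
      { map_add := fun _ _ => rfl
        map_smul := fun _ _ => rfl
        bound := ⟨1, one_pos, fun x => by simp⟩ }
  have h : ContDiffAt ℝ ∞ (fun y => (η y).curryLeft) x := hc.contDiffAt.comp x hη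
  exact h.clm_apply hX

/-- The Lie derivative `L_X η = d(ι_X η) + ι_X(dη)`. -/
def lieDeriv {E : Type} [NormedAddCommGroup E] [NormedSpace ℝ E]
    {k : ℕ} (X : SmoothVectorField E) (η : smoothForms E (k + 1)) :
    smoothForms E (k + 1) :=
  ⟨fun x => extDeriv (interiorProd X.1 η.1) x + interiorProd X.1 (extDeriv η.1) x, by
    have h1 : SmoothNearZero X.1 := X.2
    have h2 : SmoothNearZero η.1 := η.2
    change SmoothNearZero _
    filter_upwards [h1, h2] with x hX hη
    exact (extDeriv_contDiffAt (interiorProd_contDiffAt hX hη)).add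
      (interiorProd_contDiffAt hX (extDeriv_contDiffAt hη))⟩

/-! ### The singularity `W_8` -/

/-- The space `ℝ^{2n}`. -/
abbrev Space (n : ℕ) : Type := Fin (2 * n) → ℝ

/-- The index of the coordinate `x_1`, `x_2`, `x_3` (numbered `0, 1, 2`) in `ℝ^{2n}`, `n ≥ 2`. -/
def idx {n : ℕ} (hn : 2 ≤ n) : Fin 3 → Fin (2 * n) := Fin.castLE (by omega)

/-- The coordinate functions `x_1, x_2, x_3` (numbered `0, 1, 2`) on `ℝ^{2n}`, `n ≥ 2`. -/
def coord {n : ℕ} (hn : 2 ≤ n) (a : Fin 3) (x : Space n) : ℝ := x (idx hn a)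

theorem coord_contDiff {n : ℕ} (hn : 2 ≤ n) (a : Fin 3) : ContDiff ℝ ∞ (coord hn a) :=
  contDiff_apply ℝ ℝ _

/-- `W_8 = {x : x_1² + x_3³ = x_2² + x_1 x_3 = x_{≥ 4} = 0} ⊆ ℝ^{2n}`. -/
def W8 {n : ℕ} (hn : 2 ≤ n) : Set (Space n) :=
  {x | coord hn 0 x ^ 2 + coord hn 2 x ^ 3 = 0 ∧ coord hn 1 x ^ 2 + coord hn 0 x * coord hn 2 x = 0
    ∧ ∀ i : Fin (2 * n), 3 ≤ i.val → x i = 0}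

/-- The constant `2`-form `dx_a ∧ dx_b`. -/
def dxdx {n : ℕ} (hn : 2 ≤ n) (a b : Fin 3) : (Space n) [⋀^Fin 2]→L[ℝ] ℝ where
  toFun v := coord hn a (v 0) * coord hn b (v 1) - coord hn b (v 0) * coord hn a (v 1)
  map_update_add' := by
    intro _ m i x y
    fin_cases i <;> simp [coord, Function.update] <;> ring
  map_update_smul' := by
    intro _ m i c x
    fin_cases i <;> simp [coord, Function.update] <;> ring
  cont := by
    unfold coord
    fun_prop
  map_eq_zero_of_eq' := by
    intro v i j h hij
    have h01 : v 0 = v 1 := by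
      fin_cases i <;> fin_cases j <;> simp_all
    simp only [h01]
    ring

/-- The `2`-forms `θ_1, …, θ_8` (numbered `0, …, 7`). -/
def thetaField {n : ℕ} (hn : 2 ≤ n) : Fin 8 → FormField (Space n) 2 :=
  ![fun _ => dxdx hn 1 2,
    fun _ => dxdx hn 0 2,
    fun _ => dxdx hn 0 1,
    fun x => coord hn 2 x • dxdx hn 1 2,
    fun x => coord hn 1 x • dxdx hn 1 2,
    fun x => coord hn 0 x • dxdx hn 1 2 + coord hn 1 x • dxdx hn 0 2,
    fun x => coord hn 2 x ^ 2 • dxdx hn 1 2,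
    fun x => coord hn 1 x ^ 2 • dxdx hn 1 2]

/-- The germs of the forms `θ_1, …, θ_8` (numbered `0, …, 7`). -/
def theta {n : ℕ} (hn : 2 ≤ n) (j : Fin 8) : smoothForms (Space n) 2 :=
  ⟨thetaField hn j, Eventually.of_forall fun x => by
    have h0 := coord_contDiff hn 0
    have h1 := coord_contDiff hn 1
    have h2 := coord_contDiff hn 2
    refine ContDiff.contDiffAt ?_
    fin_cases j <;> simp [thetaField] <;> fun_prop⟩

/-- The Euler vector field `E = 6 x_1 ∂/∂x_1 + 5 x_2 ∂/∂x_2 + 4 x_3 ∂/∂x_3`. -/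
def euler {n : ℕ} (hn : 2 ≤ n) (x : Space n) : Space n :=
  Pi.single (idx hn 0) (6 * coord hn 0 x) + Pi.single (idx hn 1) (5 * coord hn 1 x)
    + Pi.single (idx hn 2) (4 * coord hn 2 x)

/-- The monomials `1, x_3, x_2, x_1, x_3², x_2 x_3, x_2², x_1 x_3`. -/
def monomial {n : ℕ} (hn : 2 ≤ n) : Fin 8 → Space n → ℝ :=
  ![fun _ => 1,
    fun x => coord hn 2 x,
    fun x => coord hn 1 x,
    fun x => coord hn 0 x,
    fun x => coord hn 2 x ^ 2,
    fun x => coord hn 1 x * coord hn 2 x,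
    fun x => coord hn 1 x ^ 2,
    fun x => coord hn 0 x * coord hn 2 x]

/-- The vector fields `X_0 = E`, `X_1 = x_3 E`, `X_2 = x_2 E`, `X_3 = x_1 E`, `X_4 = x_3² E`,
`X_5 = x_2 x_3 E`, `X_6 = x_2² E`, `X_7 = x_1 x_3 E`. -/
def vectorField {n : ℕ} (hn : 2 ≤ n) (i : Fin 8) : SmoothVectorField (Space n) :=
  ⟨fun x => monomial hn i x • euler hn x, Eventually.of_forall fun x => by
    have h0 := coord_contDiff hn 0
    have h1 := coord_contDiff hn 1
    have h2 := coord_contDiff hn 2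
    have hm : ContDiff ℝ ∞ (monomial hn i) := by
      fin_cases i <;> simp [monomial] <;> fun_prop
    have he : ContDiff ℝ ∞ (euler hn) := by
      have hs : ∀ a : Fin 3, ContDiff ℝ ∞ (fun r : ℝ => (Pi.single (idx hn a) r : Space n)) :=
        fun a => (ContinuousLinearMap.single ℝ (fun _ : Fin (2 * n) => ℝ) (idx hn a)).contDiff
      unfold euler
      exact (((hs 0).comp (contDiff_const.mul h0)).add
        ((hs 1).comp (contDiff_const.mul h1))).add ((hs 2).comp (contDiff_const.mul h2))
    exact (hm.smul he).contDiffAt⟩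

end AlgRestrW8

end

/-! The set `W8` is the image of the curve t ↦ (t⁶, t⁵, −t⁴, 0, …), and at the point of parameter t
the Euler field E is t times the velocity. A function vanishing on `W8` is zero all along the curve,
so every functional multiple X of E is tangent (`vanishesOn_fderiv_vectorField`). Since L_X(α + dβ)
= L_X α + d(L_X β), the Lie derivative then descends to algebraic restrictions
(`lieDeriv_mem_zeroRestriction`).

For a 1-form η, the class [dη] depends only on the values of η at the points of `W8`, and adding
a·dH₁ + b·dH₂ does not change it, where H₁, H₂ are the two equations: a·dH = d(aH) − H·da
(`HasDRestriction.of_eqOn`). Let e_j be the contraction of θ_j with E. As θ_j is closed and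
quasi-homogeneous of weight w_j, de_j = w_j θ_j. On `W8`, modulo dH₁ and dH₂, every product of a
listed monomial m_i with e_j is an explicit multiple c·e_k (`monomial_mul_eulerTheta_curve`). Since
L_{X_i} θ_j = d(m_i e_j), the table entry is c·w_k [θ_k].

Spanning: integrating a closed 2-form along quasi-homogeneous dilations yields a primitive which, on
`W8`, is a combination of e_1, e_2, e_3 with smooth coefficients plus terms H_b dx_b with b ≥ 4.
Hadamard's lemma splits a coefficient into a constant and multiples of the coordinates; a coordinate
times e_j is 0 or a multiple of some e_k with k > j, so descending induction leaves constant
coefficients only (`algRestriction_mem_thetaSpan`).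

Independence: if Σ c_j θ_j = α + dβ with α, β vanishing on `W8`, the components of α and β vanish
along the curve. The coefficients of t^k with k < 16 give linear relations between their Taylor
coefficients of order at most 3 (`pderiv_relations`). Comparing values and derivatives of order at
most 2 at 0 then forces every c_j to vanish. -/

noncomputable section

namespace AlgRestrW8

/-! ### Parameter integrals, Hadamard's lemma and the Poincaré lemma. -/

section

theorem hasFDerivAt_integral_of_contDiff {E F : Type} [NormedAddCommGroup E] [NormedSpace ℝ E]
    [FiniteDimensional ℝ E] [NormedAddCommGroup F] [NormedSpace ℝ F] {G : ℝ × E → F}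
    (hG : ContDiff ℝ 1 G) (x : E) :
    HasFDerivAt (fun x => ∫ s in (0 : ℝ)..1, G (s, x))
      (∫ s in (0 : ℝ)..1, (fderiv ℝ G (s, x)).comp (ContinuousLinearMap.inr ℝ ℝ E)) x := by
  have hc : Continuous fun p : ℝ × E =>
      (fderiv ℝ G p).comp (ContinuousLinearMap.inr ℝ ℝ E) :=
    (hG.continuous_fderiv one_ne_zero).clm_comp continuous_const
  have : ProperSpace E := FiniteDimensional.proper ℝ E
  -- Compactness of [0, 1] times a closed ball supplies the constant that dominates the derivative
  -- near `x`.
  obtain ⟨C, hC⟩ := ((isCompact_uIcc (a := (0 : ℝ)) (b := 1)).prod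
    (isCompact_closedBall x 1)).exists_bound_of_continuousOn hc.continuousOn
  refine intervalIntegral.hasFDerivAt_integral_of_dominated_of_fderiv_le
    (F' := fun x s => (fderiv ℝ G (s, x)).comp (ContinuousLinearMap.inr ℝ ℝ E))
    (bound := fun _ => C) (Metric.closedBall_mem_nhds x one_pos) ?_ ?_ ?_ ?_ ?_ ?_
  · exact Eventually.of_forall fun y =>
      (hG.continuous.comp (Continuous.prodMk_left y)).aestronglyMeasurable
  · exact (hG.continuous.comp (Continuous.prodMk_left x)).intervalIntegrable _ _
  · exact (hc.comp (Continuous.prodMk_left x)).aestronglyMeasurable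
  · exact Eventually.of_forall fun s hs y hy => hC (s, y) ⟨Set.uIoc_subset_uIcc hs, hy⟩
  · exact intervalIntegrable_const
  · refine Eventually.of_forall fun s _ y _ => ?_
    have h1 : HasFDerivAt (fun y : E => (s, y)) (ContinuousLinearMap.inr ℝ ℝ E) y :=
      hasFDerivAt_prodMk_right s y
    exact ((hG.differentiable one_ne_zero (s, y)).hasFDerivAt).comp y h1

/-- The target `F` is quantified after `n` because the induction passes to the derivative, whose
values lie in another space. -/
theorem contDiff_integral_nat {E : Type} [NormedAddCommGroup E] [NormedSpace ℝ E]
    [FiniteDimensional ℝ E] (n : ℕ) : ∀ {F : Type} [NormedAddCommGroup F] [NormedSpace ℝ F]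
    {G : ℝ × E → F}, ContDiff ℝ ∞ G → ContDiff ℝ n fun x => ∫ s in (0 : ℝ)..1, G (s, x) := by
  induction n with
  | zero =>
    intro F _ _ G hG
    rw [Nat.cast_zero, contDiff_zero]
    exact continuous_iff_continuousAt.2 fun x =>
      (hasFDerivAt_integral_of_contDiff (hG.of_le (by exact_mod_cast le_top)) x).continuousAt
  | succ n ih =>
    intro F _ _ G hG
    rw [Nat.cast_succ, contDiff_succ_iff_hasFDerivAt]
    refine ⟨_, ?_, fun x =>
      hasFDerivAt_integral_of_contDiff (hG.of_le (by exact_mod_cast le_top)) x⟩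
    exact ih (G := fun p => (fderiv ℝ G p).comp (ContinuousLinearMap.inr ℝ ℝ E))
      ((hG.fderiv_right (m := ∞) le_rfl).clm_comp contDiff_const)

theorem contDiff_integral {E F : Type} [NormedAddCommGroup E] [NormedSpace ℝ E]
    [FiniteDimensional ℝ E] [NormedAddCommGroup F] [NormedSpace ℝ F] {G : ℝ × E → F}
    (hG : ContDiff ℝ ∞ G) : ContDiff ℝ ∞ fun x => ∫ s in (0 : ℝ)..1, G (s, x) :=
  contDiff_infty.2 fun n => contDiff_integral_nat n hG

theorem clm_apply_eq_sum {ι F : Type} [Fintype ι] [DecidableEq ι] [NormedAddCommGroup F]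
    [NormedSpace ℝ F] (φ : (ι → ℝ) →L[ℝ] F) (x : ι → ℝ) :
    φ x = ∑ i, x i • φ (Pi.single i 1) := by
  have h := congrArg φ (pi_eq_sum_univ' x)
  simpa [map_sum] using h

/-- Hadamard's lemma. -/
theorem exists_hadamard {ι : Type} [Fintype ι] [DecidableEq ι] {f : (ι → ℝ) → ℝ}
    (hf : ContDiff ℝ ∞ f) :
    ∃ g : ι → (ι → ℝ) → ℝ, (∀ i, ContDiff ℝ ∞ (g i)) ∧ ∀ x, f x = f 0 + ∑ i, x i * g i x := by
  have hG : ∀ i : ι, ContDiff ℝ ∞ fun p : ℝ × (ι → ℝ) =>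
      fderiv ℝ f (p.1 • p.2) (Pi.single i 1) := fun i =>
    ((hf.fderiv_right (m := ∞) le_rfl).comp (contDiff_fst.smul contDiff_snd)).clm_apply
      contDiff_const
  refine ⟨fun i x => ∫ s in (0 : ℝ)..1, fderiv ℝ f (s • x) (Pi.single i 1),
    fun i => contDiff_integral (hG i), fun x => ?_⟩
  have hd : ∀ s ∈ Set.uIcc (0 : ℝ) 1,
      HasDerivAt (fun s : ℝ => f (s • x)) (fderiv ℝ f (s • x) x) s := fun s _ => by
    have h1 : HasDerivAt (fun s : ℝ => s • x) x s := by
      simpa using (hasDerivAt_id s).smul_const x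
    exact ((hf.differentiable (by simp) (s • x)).hasFDerivAt).comp_hasDerivAt s h1
  have hc : ∀ i, Continuous fun s : ℝ => fderiv ℝ f (s • x) (Pi.single i 1) := fun i =>
    (hG i).continuous.comp (Continuous.prodMk_left x)
  have hx : ∀ s : ℝ, fderiv ℝ f (s • x) x = ∑ i, x i * fderiv ℝ f (s • x) (Pi.single i 1) := by
    intro s
    simpa using clm_apply_eq_sum (fderiv ℝ f (s • x)) x
  have hI : ∀ i ∈ Finset.univ, IntervalIntegrable
      (fun s : ℝ => x i * fderiv ℝ f (s • x) (Pi.single i 1)) MeasureTheory.volume 0 1 :=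
    fun i _ => (continuous_const.mul (hc i)).intervalIntegrable _ _
  have h := intervalIntegral.integral_eq_sub_of_hasDerivAt hd (by
    simp_rw [hx]
    exact (continuous_finsetSum _ fun i _ => continuous_const.mul (hc i)).intervalIntegrable _ _)
  simp_rw [hx] at h
  rw [intervalIntegral.integral_finsetSum hI] at h
  simp_rw [intervalIntegral.integral_const_mul] at h
  rw [h]
  simp

/-- Cutting off with a bump function leaves the germ unchanged; it makes the global statements on
parameter integrals applicable to germs. -/
theorem SmoothNearZero.exists_contDiff {E F : Type} [NormedAddCommGroup E] [NormedSpace ℝ E]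
    [FiniteDimensional ℝ E] [NormedAddCommGroup F] [NormedSpace ℝ F] {f : E → F}
    (hf : SmoothNearZero f) : ∃ g : E → F, ContDiff ℝ ∞ g ∧ g =ᶠ[𝓝 0] f := by
  obtain ⟨r, hr, h⟩ := Metric.eventually_nhds_iff_ball.1 hf
  let b : ContDiffBump (0 : E) := ⟨r / 4, r / 2, by positivity, by linarith⟩
  refine ⟨fun x => b x • f x, ?_, ?_⟩
  · rw [contDiff_iff_contDiffAt]
    intro x
    by_cases hx : x ∈ Metric.ball (0 : E) r
    · exact b.contDiffAt.smul (h x hx)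
    · have h0 : (fun x => b x • f x) =ᶠ[𝓝 x] fun _ => 0 := by
        have : (Metric.closedBall (0 : E) (r / 2))ᶜ ∈ 𝓝 x := by
          refine Metric.isClosed_closedBall.isOpen_compl.mem_nhds ?_
          simp only [Metric.mem_ball, Set.mem_compl_iff, Metric.mem_closedBall] at hx ⊢
          linarith
        filter_upwards [this] with y hy
        have : b y = 0 := b.zero_of_le_dist (by
          simp only [Set.mem_compl_iff, Metric.mem_closedBall, not_le] at hy
          exact hy.le)
        simp [this]
      exact contDiffAt_const.congr_of_eventuallyEq h0
  · filter_upwards [b.eventuallyEq_one] with x hx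
    simp [hx]

/-- The Poincaré lemma for the contraction `Φ` of `E` to `0`. -/
theorem exists_primitive_of_contraction {E : Type} [NormedAddCommGroup E] [NormedSpace ℝ E]
    [FiniteDimensional ℝ E] {B : E → E →L[ℝ] E →L[ℝ] ℝ} (hB : ContDiff ℝ ∞ B)
    (hanti : ∀ x u v, B x u v = -B x v u) {r : ℝ}
    (hclosed : ∀ x ∈ Metric.ball (0 : E) r, ∀ u v w,
      fderiv ℝ B x u v w - fderiv ℝ B x v u w + fderiv ℝ B x w u v = 0)
    {Φ : ℝ → E →L[ℝ] E} (hΦ : ContDiff ℝ ∞ Φ) (h0 : Φ 0 = 0)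
    (h1 : Φ 1 = ContinuousLinearMap.id ℝ E)
    (hball : ∀ s ∈ Set.Icc (0 : ℝ) 1, ∀ x, ‖Φ s x‖ ≤ ‖x‖) :
    ∃ η : E → E →L[ℝ] ℝ, ContDiff ℝ ∞ η ∧
      (∀ x ∈ Metric.ball (0 : E) r, ∀ u v, fderiv ℝ η x u v - fderiv ℝ η x v u = B x u v) ∧
      ∀ x v, η x v = ∫ s in (0 : ℝ)..1, B (Φ s x) (deriv Φ s x) (Φ s v) := by
  have hΦ' : ContDiff ℝ ∞ (deriv Φ) := ((contDiff_succ_iff_deriv (n := ∞)).1 hΦ).2.2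
  have hΦd : ∀ s, HasDerivAt Φ (deriv Φ s) s := fun s =>
    (hΦ.differentiable (by simp) s).hasDerivAt
  -- This is the 1-form of Cartan's homotopy formula: `B` contracted with ∂ₛΦ and pulled back by Φ.
  let G : ℝ × E → E →L[ℝ] ℝ := fun p => (B (Φ p.1 p.2) (deriv Φ p.1 p.2)).comp (Φ p.1)
  have hG : ContDiff ℝ ∞ G := by
    have e1 : ContDiff ℝ ∞ fun p : ℝ × E => Φ p.1 := hΦ.comp contDiff_fst
    have e2 : ContDiff ℝ ∞ fun p : ℝ × E => deriv Φ p.1 := hΦ'.comp contDiff_fst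
    exact ((hB.comp (e1.clm_apply contDiff_snd)).clm_apply (e2.clm_apply contDiff_snd)).clm_comp e1
  have hG1 : ContDiff ℝ 1 G := hG.of_le (by exact_mod_cast le_top)
  have hGc : ∀ x, Continuous fun s : ℝ => G (s, x) := fun x =>
    hG.continuous.comp (Continuous.prodMk_left x)
  have hGc' : ∀ x, Continuous fun s : ℝ =>
      (fderiv ℝ G (s, x)).comp (ContinuousLinearMap.inr ℝ ℝ E) := fun x =>
    ((hG1.continuous_fderiv one_ne_zero).comp (Continuous.prodMk_left x)).clm_comp continuous_const
  have hder : ∀ s x u v, fderiv ℝ G (s, x) (0, u) v =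
      fderiv ℝ B (Φ s x) (Φ s u) (deriv Φ s x) (Φ s v) + B (Φ s x) (deriv Φ s u) (Φ s v) := by
    intro s x u v
    have a1 : HasFDerivAt (fun y : E => G (s, y))
        ((fderiv ℝ G (s, x)).comp (ContinuousLinearMap.inr ℝ ℝ E)) x :=
      ((hG1.differentiable one_ne_zero (s, x)).hasFDerivAt).comp x (hasFDerivAt_prodMk_right s x)
    have a2 : HasFDerivAt (fun y : E => B (Φ s y)) ((fderiv ℝ B (Φ s x)).comp (Φ s)) x :=
      ((hB.differentiable (by simp) _).hasFDerivAt).comp x (Φ s).hasFDerivAt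
    have a3 := ((a2.clm_apply (deriv Φ s).hasFDerivAt).clm_comp (hasFDerivAt_const (Φ s) x))
    have a4 := congrArg (fun T : E →L[ℝ] E →L[ℝ] ℝ => T u v) (a1.unique a3)
    simp at a4
    rw [a4]
    ring
  refine ⟨fun x => ∫ s in (0 : ℝ)..1, G (s, x), contDiff_integral hG, ?_, ?_⟩
  · intro x hx u v
    have hF : ∀ u v, fderiv ℝ (fun x => ∫ s in (0 : ℝ)..1, G (s, x)) x u v =
        ∫ s in (0 : ℝ)..1, fderiv ℝ G (s, x) (0, u) v := by
      intro u v
      rw [(hasFDerivAt_integral_of_contDiff hG1 x).fderiv,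
        ContinuousLinearMap.intervalIntegral_apply ((hGc' x).intervalIntegrable _ _),
        ContinuousLinearMap.intervalIntegral_apply
          (((hGc' x).clm_apply continuous_const).intervalIntegrable _ _)]
      simp
    have hI : ∀ u v, IntervalIntegrable (fun s => fderiv ℝ G (s, x) (0, u) v)
        MeasureTheory.volume 0 1 := by
      intro u v
      have := ((hGc' x).clm_apply (continuous_const (y := u))).clm_apply
        (continuous_const (y := v))
      simpa using this.intervalIntegrable 0 1
    rw [hF, hF, ← intervalIntegral.integral_sub (hI u v) (hI v u)]
    -- As `B` is closed at `Φ s x`, the s-derivative of the pullback of `B` by `Φ s` is the exterior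
    -- derivative of `G` at time s. Integration gives the pullback at time 1, which is `B`, minus
    -- the one at time 0, which is 0.
    have hd : ∀ s ∈ Set.uIcc (0 : ℝ) 1, HasDerivAt (fun s => B (Φ s x) (Φ s u) (Φ s v))
        (fderiv ℝ G (s, x) (0, u) v - fderiv ℝ G (s, x) (0, v) u) s := by
      intro s hs
      rw [Set.uIcc_of_le zero_le_one] at hs
      have b0 : ∀ w, HasDerivAt (fun s => Φ s w) (deriv Φ s w) s := fun w => by
        simpa using (hΦd s).clm_apply (hasDerivAt_const s w)
      have b1 : HasDerivAt (fun s => B (Φ s x)) (fderiv ℝ B (Φ s x) (deriv Φ s x)) s :=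
        ((hB.differentiable (by simp) _).hasFDerivAt).comp_hasDerivAt s (b0 x)
      have b2 := (b1.clm_apply (b0 u)).clm_apply (b0 v)
      refine b2.congr_deriv ?_
      have hm : Φ s x ∈ Metric.ball (0 : E) r := by
        rw [mem_ball_zero_iff] at hx ⊢
        exact (hball s hs x).trans_lt hx
      have c1 := hclosed _ hm (Φ s u) (deriv Φ s x) (Φ s v)
      -- Antisymmetry of `B` at every point is inherited by its derivative in each direction.
      have c2 : ∀ a u v, fderiv ℝ B (Φ s x) a u v = -fderiv ℝ B (Φ s x) a v u := by
        intro a u v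
        have d1 : ∀ u v, HasFDerivAt (fun y => B y u v)
            (((fderiv ℝ B (Φ s x)).flip u).flip v) (Φ s x) := by
          intro u v
          have := ((hB.differentiable (by simp) (Φ s x)).hasFDerivAt.clm_apply
            (hasFDerivAt_const u _)).clm_apply (hasFDerivAt_const v _)
          exact this.congr_fderiv (by ext w; simp)
        have d2 := (d1 v u).neg
        have d3 : (fun y => B y u v) = -fun y => B y v u := by
          funext y
          simpa using hanti y u v
        have d4 := (d1 u v)
        rw [d3] at d4
        simpa using congrArg (fun T : E →L[ℝ] ℝ => T a) (d4.unique d2)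
      rw [hder, hder, add_apply]
      rw [hanti _ (Φ s u) (deriv Φ s v), c2 (Φ s v) (deriv Φ s x) (Φ s u)]
      linarith
    rw [intervalIntegral.integral_eq_sub_of_hasDerivAt hd ((hI u v).sub (hI v u))]
    simp [h0, h1]
  · intro x v
    rw [ContinuousLinearMap.intervalIntegral_apply ((hGc x).intervalIntegrable _ _)]
    rfl

end

/-! ### Calculus of algebraic restrictions and Lie derivatives. -/

section

section General

variable {E : Type} [NormedAddCommGroup E] [NormedSpace ℝ E]

theorem two_le_infty : minSmoothness ℝ 2 ≤ (∞ : WithTop ℕ∞) := by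
  rw [minSmoothness_of_isRCLikeNormedField]
  exact ENat.LEInfty.out

theorem form_one_ext {σ σ' : E [⋀^Fin 1]→L[ℝ] ℝ} (h : ∀ v, σ ![v] = σ' ![v]) : σ = σ' := by
  ext v
  rw [show v = ![v 0] by ext i; fin_cases i; rfl]
  exact h _

theorem form_two_ext {σ σ' : E [⋀^Fin 2]→L[ℝ] ℝ} (h : ∀ u v, σ ![u, v] = σ' ![u, v]) :
    σ = σ' := by
  ext v
  rw [show v = ![v 0, v 1] by ext i; fin_cases i <;> rfl]
  exact h _ _

theorem form_two_swap (σ : E [⋀^Fin 2]→L[ℝ] ℝ) (u v : E) : σ ![u, v] = -σ ![v, u] := by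
  have h := σ.map_swap ![v, u] (show (0 : Fin 2) ≠ 1 by decide)
  have e : ![v, u] ∘ Equiv.swap (0 : Fin 2) 1 = ![u, v] := by
    ext i
    fin_cases i <;> simp
  rw [e] at h
  exact h

theorem extDeriv_one_apply (β : FormField E 1) (x u v : E) :
    extDeriv β x ![u, v] = fderiv ℝ β x u ![v] - fderiv ℝ β x v ![u] := by
  have h0 : (0 : Fin 2).removeNth ![u, v] = ![v] := by ext i; fin_cases i; rfl
  have h1 : (1 : Fin 2).removeNth ![u, v] = ![u] := by ext i; fin_cases i; rfl
  rw [extDeriv, ContinuousAlternatingMap.alternatizeUncurryFin_apply, Fin.sum_univ_two, h0, h1]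
  simp [sub_eq_add_neg]

theorem extDeriv_two_apply (α : FormField E 2) (x u v w : E) :
    extDeriv α x ![u, v, w] =
      fderiv ℝ α x u ![v, w] - fderiv ℝ α x v ![u, w] + fderiv ℝ α x w ![u, v] := by
  have h0 : (0 : Fin 3).removeNth ![u, v, w] = ![v, w] := by ext i; fin_cases i <;> rfl
  have h1 : (1 : Fin 3).removeNth ![u, v, w] = ![u, w] := by ext i; fin_cases i <;> rfl
  have h2 : (2 : Fin 3).removeNth ![u, v, w] = ![u, v] := by ext i; fin_cases i <;> rfl
  rw [extDeriv, ContinuousAlternatingMap.alternatizeUncurryFin_apply, Fin.sum_univ_three, h0, h1,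
    h2]
  simp [sub_eq_add_neg]

theorem hasFDerivAt_form_apply {k : ℕ} {β : FormField E k} {x : E} (h : DifferentiableAt ℝ β x)
    (v : Fin k → E) (u : E) : fderiv ℝ (fun y => β y v) x u = fderiv ℝ β x u v := by
  rw [fderiv_continuousAlternatingMap_apply_const_apply h]

theorem SmoothNearZero.add {F : Type} [NormedAddCommGroup F] [NormedSpace ℝ F] {f g : E → F}
    (hf : SmoothNearZero f) (hg : SmoothNearZero g) : SmoothNearZero (f + g) := by
  filter_upwards [hf, hg] with x h1 h2 using h1.add h2

theorem SmoothNearZero.sub {F : Type} [NormedAddCommGroup F] [NormedSpace ℝ F] {f g : E → F}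
    (hf : SmoothNearZero f) (hg : SmoothNearZero g) : SmoothNearZero (f - g) := by
  filter_upwards [hf, hg] with x h1 h2 using h1.sub h2

theorem SmoothNearZero.const_smul {F : Type} [NormedAddCommGroup F] [NormedSpace ℝ F] {f : E → F}
    (hf : SmoothNearZero f) (c : ℝ) : SmoothNearZero (c • f) := by
  filter_upwards [hf] with x h1 using h1.const_smul c

theorem _root_.ContDiff.smoothNearZero {F : Type} [NormedAddCommGroup F] [NormedSpace ℝ F]
    {f : E → F} (hf : ContDiff ℝ ∞ f) : SmoothNearZero f :=
  Eventually.of_forall fun _ => hf.contDiffAt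

theorem SmoothNearZero.extDeriv {k : ℕ} {η : FormField E k} (h : SmoothNearZero η) :
    SmoothNearZero (_root_.extDeriv η) := by
  filter_upwards [h] with x hx using extDeriv_contDiffAt hx

theorem SmoothNearZero.interiorProd {k : ℕ} {X : E → E} {η : FormField E (k + 1)}
    (hX : SmoothNearZero X) (h : SmoothNearZero η) : SmoothNearZero (interiorProd X η) := by
  filter_upwards [hX, h] with x h1 h2 using interiorProd_contDiffAt h1 h2

theorem algRestriction_eq_iff {N : Set E} {k : ℕ} {η η' : smoothForms E (k + 1)} :
    algRestriction N η = algRestriction N η' ↔ η - η' ∈ zeroRestriction N k := by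
  rw [algRestriction, algRestriction, Submodule.mkQ_apply, Submodule.mkQ_apply,
    Submodule.Quotient.eq]

theorem algRestriction_congr {N : Set E} {k : ℕ} {η η' : smoothForms E (k + 1)}
    (h : η.1 =ᶠ[𝓝 0] η'.1) : algRestriction N η = algRestriction N η' := by
  rw [algRestriction_eq_iff]
  refine ⟨0, 0, contDiff_const.smoothNearZero, contDiff_const.smoothNearZero,
    Eventually.of_forall fun _ _ => rfl, Eventually.of_forall fun _ _ => rfl, ?_⟩
  filter_upwards [h] with x hx
  have h0 := extDeriv_smul (x := x) (0 : ℝ) (0 : FormField E k)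
  rw [zero_smul, zero_smul] at h0
  simp [h0, hx]

/-- The exterior derivative of the germ of the `1`-form `η` has the algebraic restriction `c`
to `N`. -/
def HasDRestriction (N : Set E) (η : FormField E 1) (c : AlgRestriction N 1) : Prop :=
  ∃ h : SmoothNearZero η, algRestriction N (⟨extDeriv η, h.extDeriv⟩ : smoothForms E 2) = c

variable {N : Set E}

theorem HasDRestriction.add {η η' : FormField E 1} {c c' : AlgRestriction N 1}
    (h : HasDRestriction N η c) (h' : HasDRestriction N η' c') :
    HasDRestriction N (η + η') (c + c') := by
  obtain ⟨hs, rfl⟩ := h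
  obtain ⟨hs', rfl⟩ := h'
  refine ⟨hs.add hs', ?_⟩
  rw [← map_add]
  apply algRestriction_congr
  filter_upwards [hs, hs'] with x h1 h2
  exact extDeriv_add (h1.differentiableAt (by simp)) (h2.differentiableAt (by simp))

theorem HasDRestriction.const_smul {η : FormField E 1} {c : AlgRestriction N 1}
    (h : HasDRestriction N η c) (a : ℝ) : HasDRestriction N (a • η) (a • c) := by
  obtain ⟨hs, rfl⟩ := h
  refine ⟨hs.const_smul a, ?_⟩
  rw [← map_smul]
  exact algRestriction_congr (Eventually.of_forall fun x => extDeriv_smul a η)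

/-- The difference of the two 1-forms vanishes on `N`, so it is an admissible β and its differential
has zero restriction. -/
theorem HasDRestriction.congr {η η' : FormField E 1} {c : AlgRestriction N 1}
    (h : HasDRestriction N η c) (hs' : SmoothNearZero η')
    (hN : ∀ᶠ x in 𝓝 (0 : E), x ∈ N → η' x = η x) : HasDRestriction N η' c := by
  obtain ⟨hs, rfl⟩ := h
  refine ⟨hs', ?_⟩
  rw [algRestriction_eq_iff]
  refine ⟨0, η' - η, contDiff_const.smoothNearZero, hs'.sub hs,
    Eventually.of_forall fun _ _ => rfl, ?_, ?_⟩
  · filter_upwards [hN] with x hx hxN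
    simp [hx hxN]
  · filter_upwards [hs, hs'] with x h1 h2
    have h3 := extDeriv_add (h2.differentiableAt (by simp))
      ((h1.differentiableAt (by simp)).const_smul (-1 : ℝ))
    rw [extDeriv_smul] at h3
    rw [neg_one_smul, show (-1 : ℝ) • η = -η from neg_one_smul ℝ η] at h3
    simpa [sub_eq_add_neg] using h3.symm

theorem HasDRestriction.zero : HasDRestriction N (0 : FormField E 1) 0 := by
  have hs : SmoothNearZero (0 : FormField E 1) := contDiff_const.smoothNearZero
  have h : HasDRestriction N (0 : FormField E 1) _ := ⟨hs, rfl⟩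
  simpa using h.const_smul 0

theorem HasDRestriction.sum {ι : Type} (s : Finset ι) {η : ι → FormField E 1}
    {c : ι → AlgRestriction N 1} (h : ∀ i ∈ s, HasDRestriction N (η i) (c i)) :
    HasDRestriction N (∑ i ∈ s, η i) (∑ i ∈ s, c i) := by
  classical
  induction s using Finset.induction_on with
  | empty => simpa using HasDRestriction.zero
  | insert i s hi ih =>
    rw [Finset.sum_insert hi, Finset.sum_insert hi]
    exact (h i (Finset.mem_insert_self i s)).add
      (ih fun j hj => h j (Finset.mem_insert_of_mem hj))

/-- The `1`-form with coefficient functional `φ`. -/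
def oneForm (φ : E → E →L[ℝ] ℝ) : FormField E 1 := fun x =>
  ContinuousAlternatingMap.ofSubsingletonLIE (𝕜 := ℝ) (E := E) (F := ℝ) (0 : Fin 1) (φ x)

@[simp]
theorem oneForm_apply (φ : E → E →L[ℝ] ℝ) (x v : E) : oneForm φ x ![v] = φ x v := rfl

theorem contDiff_oneForm {φ : E → E →L[ℝ] ℝ} (h : ContDiff ℝ ∞ φ) : ContDiff ℝ ∞ (oneForm φ) :=
  (ContinuousAlternatingMap.ofSubsingletonLIE (𝕜 := ℝ) (E := E) (F := ℝ) (0 : Fin 1)).contDiff.comp h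

theorem fderiv_oneForm {φ : E → E →L[ℝ] ℝ} {x : E} (h : DifferentiableAt ℝ φ x) (u v : E) :
    fderiv ℝ (oneForm φ) x u ![v] = fderiv ℝ φ x u v := by
  have h1 : HasFDerivAt (oneForm φ) _ x :=
    ((ContinuousAlternatingMap.ofSubsingletonLIE (𝕜 := ℝ) (E := E) (F := ℝ)
      (0 : Fin 1)).toContinuousLinearEquiv.hasFDerivAt (x := φ x)).comp x h.hasFDerivAt
  rw [h1.fderiv]
  rfl

theorem extDeriv_oneForm_fderiv {g : E → ℝ} (hg : ContDiff ℝ ∞ g) (x : E) :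
    extDeriv (oneForm (fderiv ℝ g)) x = 0 := by
  have h : oneForm (fderiv ℝ g) = extDeriv fun x =>
      ContinuousAlternatingMap.constOfIsEmpty ℝ E (Fin 0) (g x) := by
    funext y
    rw [extDeriv_constOfIsEmpty]
    rfl
  rw [h]
  refine extDeriv_extDeriv_apply (r := ∞) ?_ two_le_infty
  exact ((ContinuousAlternatingMap.constOfIsEmptyLIE ℝ E ℝ (Fin 0)).contDiff.comp hg).contDiffAt

theorem contDiff_oneForm_smul_fderiv {a g : E → ℝ} (ha : ContDiff ℝ ∞ a) (hg : ContDiff ℝ ∞ g) :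
    ContDiff ℝ ∞ (oneForm fun x => a x • fderiv ℝ g x) :=
  contDiff_oneForm (ha.smul (hg.fderiv_right (m := ∞) le_rfl))

/-- Leibniz: a·dg = d(ag) − g·da. The first term is exact, hence has differential zero, and the
second vanishes on `N`. -/
theorem HasDRestriction.smul_fderiv {a g : E → ℝ} (ha : ContDiff ℝ ∞ a) (hg : ContDiff ℝ ∞ g)
    (hN : ∀ x ∈ N, g x = 0) : HasDRestriction N (oneForm fun x => a x • fderiv ℝ g x) 0 := by
  have hs := contDiff_oneForm_smul_fderiv ha hg
  have hs' := contDiff_oneForm_smul_fderiv hg ha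
  have h1 : HasDRestriction N (oneForm (fderiv ℝ (a * g))) 0 := by
    have hag : ContDiff ℝ ∞ (oneForm (fderiv ℝ (a * g))) :=
      contDiff_oneForm ((ha.mul hg).fderiv_right (m := ∞) le_rfl)
    refine ⟨hag.smoothNearZero, ?_⟩
    rw [← map_zero (zeroRestriction N 1).mkQ]
    exact algRestriction_congr (Eventually.of_forall fun x =>
      extDeriv_oneForm_fderiv (ha.mul hg) x)
  refine h1.congr hs.smoothNearZero (Eventually.of_forall fun x hx => ?_)
  apply form_one_ext
  intro v
  have h2 : fderiv ℝ (a * g) x = a x • fderiv ℝ g x + g x • fderiv ℝ a x :=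
    fderiv_mul (ha.differentiable (by simp) x) (hg.differentiable (by simp) x)
  simp [h2, hN x hx]

theorem fderiv_interiorProd {k : ℕ} {X : E → E} {σ : FormField E (k + 1)} {x : E}
    (hX : DifferentiableAt ℝ X x) (hσ : DifferentiableAt ℝ σ x) (u : E) :
    fderiv ℝ (interiorProd X σ) x u =
      (σ x).curryLeft (fderiv ℝ X x u) + (fderiv ℝ σ x u).curryLeft (X x) := by
  have hb : IsBoundedLinearMap ℝ
      (ContinuousAlternatingMap.curryLeft (𝕜 := ℝ) (E := E) (F := ℝ) (n := k)) :=
    { map_add := fun _ _ => rfl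
      map_smul := fun _ _ => rfl
      bound := ⟨1, one_pos, fun x => by simp⟩ }
  have h1 := (IsBoundedLinearMap.hasFDerivAt (F := E →L[ℝ] E [⋀^Fin k]→L[ℝ] ℝ)
    (x := σ x) hb).comp x hσ.hasFDerivAt
  have h2 : HasFDerivAt (interiorProd X σ) _ x := h1.clm_apply hX.hasFDerivAt
  rw [h2.fderiv]
  rfl

/-- Lie derivatives along fields tangent to `N` preserve the forms with zero algebraic
restriction. -/
theorem lieDeriv_mem_zeroRestriction {X : SmoothVectorField E}
    (hX : ∀ (F : Type) [NormedAddCommGroup F] [NormedSpace ℝ F] (f : E → F), SmoothNearZero f →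
      VanishesOn N f → VanishesOn N (fun x => fderiv ℝ f x (X.1 x)))
    {η : smoothForms E 2} (hη : η ∈ zeroRestriction N 1) :
    lieDeriv X η ∈ zeroRestriction N 1 := by
  obtain ⟨α, β, hα, hβ, hαN, hβN, h⟩ := hη
  have hXs : SmoothNearZero X.1 := X.2
  -- At a zero of σ, only the term in which σ is differentiated survives.
  have key : ∀ {k : ℕ} {σ : FormField E (k + 1)} {x : E}, DifferentiableAt ℝ X.1 x →
      DifferentiableAt ℝ σ x → σ x = 0 → ∀ u,
      fderiv ℝ (interiorProd X.1 σ) x u = (fderiv ℝ σ x u).curryLeft (X.1 x) := by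
    intro k σ x hXx hσ h0 u
    rw [fderiv_interiorProd hXx hσ, h0]
    simp
  -- The witnesses are L_X α and L_X β, because L_X commutes with d.
  refine ⟨fun x => extDeriv (interiorProd X.1 α) x + interiorProd X.1 (extDeriv α) x,
    fun x => extDeriv (interiorProd X.1 β) x + interiorProd X.1 (extDeriv β) x,
    (hXs.interiorProd hα).extDeriv.add (hXs.interiorProd hα.extDeriv),
    (hXs.interiorProd hβ).extDeriv.add (hXs.interiorProd hβ.extDeriv), ?_, ?_, ?_⟩
  -- Where α = 0, the form L_X α reduces to the derivative of the coefficients of α along X, which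
  -- vanishes by tangency. The form-valued map α itself is the `f` of `hX`.
  · filter_upwards [hXs, hα, hαN, hX _ α hα hαN] with x h1 h2 h3 h4 hxN
    apply form_two_ext
    intro u v
    have k1 := key (h1.differentiableAt (by simp)) (h2.differentiableAt (by simp)) (h3 hxN)
    have h5 := h4 hxN
    rw [ContinuousAlternatingMap.add_apply, extDeriv_one_apply, k1, k1]
    simp only [interiorProd, ContinuousAlternatingMap.curryLeft_apply_apply]
    rw [show (Matrix.vecCons (X.1 x) ![u, v]) = ![X.1 x, u, v] from rfl, extDeriv_two_apply, h5]
    simp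
  · filter_upwards [hXs, hβ, hβN, hX _ β hβ hβN] with x h1 h2 h3 h4 hxN
    apply form_one_ext
    intro u
    have k1 := key (h1.differentiableAt (by simp)) (h2.differentiableAt (by simp)) (h3 hxN)
    have h5 := h4 hxN
    have h0 : (0 : Fin 1).removeNth ![u] = ![] := by ext i; exact i.elim0
    rw [ContinuousAlternatingMap.add_apply, extDeriv,
      ContinuousAlternatingMap.alternatizeUncurryFin_apply, Fin.sum_univ_one, h0]
    simp only [interiorProd, ContinuousAlternatingMap.curryLeft_apply_apply]
    rw [show (Matrix.vecCons (X.1 x) ![u]) = ![X.1 x, u] from rfl, extDeriv_one_apply, h5]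
    have k2 := k1 u
    simp [k2]
  · have h' : η.1 =ᶠ[𝓝 0] fun x => α x + extDeriv β x := h
    filter_upwards [h'.eventually_nhds, hα.eventually_nhds, hβ.eventually_nhds,
      hXs.eventually_nhds] with x h1 h2 h3 h4
    have a1 : interiorProd X.1 η.1 =ᶠ[𝓝 x]
        interiorProd X.1 α + interiorProd X.1 (extDeriv β) := by
      filter_upwards [h1] with y hy
      simp [interiorProd, hy]
    have dα := h2.self_of_nhds
    have dβ := h3.self_of_nhds
    have dX := h4.self_of_nhds
    have a2 : extDeriv (interiorProd X.1 η.1) x =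
        extDeriv (interiorProd X.1 α) x + extDeriv (interiorProd X.1 (extDeriv β)) x := by
      rw [a1.extDeriv_eq]
      exact extDeriv_add ((interiorProd_contDiffAt dX dα).differentiableAt (by simp))
        ((interiorProd_contDiffAt dX (extDeriv_contDiffAt dβ)).differentiableAt (by simp))
    have hmin := two_le_infty
    have a3 : extDeriv η.1 x = extDeriv α x := by
      rw [Filter.EventuallyEq.extDeriv_eq h1]
      have := extDeriv_add (dα.differentiableAt (by simp))
        ((extDeriv_contDiffAt dβ).differentiableAt (by simp))
      rw [extDeriv_extDeriv_apply dβ hmin, add_zero] at this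
      exact this
    have a4 : extDeriv (fun x => extDeriv (interiorProd X.1 β) x +
        interiorProd X.1 (extDeriv β) x) x = extDeriv (interiorProd X.1 (extDeriv β)) x := by
      have := extDeriv_add
        ((extDeriv_contDiffAt (interiorProd_contDiffAt dX dβ)).differentiableAt (by simp))
        ((interiorProd_contDiffAt dX (extDeriv_contDiffAt dβ)).differentiableAt (by simp))
      rw [extDeriv_extDeriv_apply (interiorProd_contDiffAt dX dβ) hmin] at this
      exact this.trans (zero_add _)
    rw [a4]
    simp only [lieDeriv, a2, interiorProd, a3]
    abel

/-- For closed η, Cartan's formula reduces to L_X η = d(ι_X η), which moves the computation to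
1-forms. -/
theorem extDeriv_interiorProd_hasDRestriction {X : SmoothVectorField E} {η : smoothForms E 2}
    (hη : extDeriv η.1 =ᶠ[𝓝 0] 0) :
    HasDRestriction N (interiorProd X.1 η.1) (algRestriction N (lieDeriv X η)) := by
  have hX : SmoothNearZero X.1 := X.2
  have h : SmoothNearZero η.1 := η.2
  refine ⟨hX.interiorProd h, algRestriction_congr ?_⟩
  filter_upwards [hη] with x hx
  simp [lieDeriv, interiorProd, hx]

end General

end

/-! ### The parametrizing curve, tangency, and relations between contracted forms. -/

section

variable {n : ℕ} (hn : 2 ≤ n)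

theorem idx_injective : Function.Injective (idx hn) := Fin.castLE_injective _

@[simp]
theorem coord_add (a : Fin 3) (x y : Space n) : coord hn a (x + y) = coord hn a x + coord hn a y :=
  rfl

@[simp]
theorem coord_smul (a : Fin 3) (c : ℝ) (x : Space n) : coord hn a (c • x) = c * coord hn a x := rfl

@[simp]
theorem coord_zero (a : Fin 3) : coord hn a (0 : Space n) = 0 := rfl

@[simp]
theorem coord_single (a b : Fin 3) (c : ℝ) :
    coord hn a (Pi.single (idx hn b) c : Space n) = if a = b then c else 0 := by
  simp [coord, Pi.single_apply, (idx_injective hn).eq_iff]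

/-- The parametrization `t ↦ (t⁶, t⁵, -t⁴, 0, …)` of `W_8`. -/
def curve (t : ℝ) : Space n :=
  Pi.single (idx hn 0) (t ^ 6) + Pi.single (idx hn 1) (t ^ 5) + Pi.single (idx hn 2) (-t ^ 4)

@[simp]
theorem coord_zero_curve (t : ℝ) : coord hn 0 (curve hn t) = t ^ 6 := by
  simp [curve]

@[simp]
theorem coord_one_curve (t : ℝ) : coord hn 1 (curve hn t) = t ^ 5 := by
  simp [curve]

@[simp]
theorem coord_two_curve (t : ℝ) : coord hn 2 (curve hn t) = -t ^ 4 := by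
  simp [curve]

theorem curve_apply_of_three_le (t : ℝ) {i : Fin (2 * n)} (hi : 3 ≤ i.val) : curve hn t i = 0 := by
  have h : ∀ a : Fin 3, i ≠ idx hn a := by
    rintro a rfl
    simp only [idx, Fin.val_castLE] at hi
    omega
  simp [curve, h]

theorem space_ext {x y : Space n} (h : ∀ a, coord hn a x = coord hn a y)
    (h' : ∀ i : Fin (2 * n), 3 ≤ i.val → x i = y i) : x = y := by
  ext i
  rcases lt_or_ge i.val 3 with hi | hi
  · exact h ⟨i.val, hi⟩
  · exact h' i hi

theorem exists_pow_five_eq (y : ℝ) : ∃ t : ℝ, t ^ 5 = y := by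
  have h5 : Odd 5 := by decide
  have hc : Continuous fun t : ℝ => t ^ 5 := by fun_prop
  have h1 : Tendsto (fun t : ℝ => t ^ 5) atTop atTop := tendsto_pow_atTop (by norm_num)
  have h2 : Tendsto (fun t : ℝ => t ^ 5) atBot atBot := by
    have h3 := tendsto_neg_atTop_atBot.comp (h1.comp tendsto_neg_atBot_atTop)
    refine h3.congr fun t => ?_
    simp [h5.neg_pow]
  exact hc.surjective h1 h2 y

theorem exists_curve_eq {x : Space n} (hx : x ∈ W8 hn) : ∃ t, x = curve hn t := by
  obtain ⟨h1, h2, h3⟩ := hx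
  obtain ⟨t, ht⟩ := exists_pow_five_eq (coord hn 1 x)
  have h5 : Odd 5 := by decide
  have hz : coord hn 2 x = -t ^ 4 := by
    refine h5.strictMono_pow.injective ?_
    -- Eliminating x_1: x_2⁴ = x_1² x_3² = −x_3⁵.
    have e : (coord hn 2 x) ^ 5 = -(coord hn 1 x) ^ 4 := by
      linear_combination coord hn 2 x ^ 2 * h1 + (coord hn 1 x ^ 2 - coord hn 0 x * coord hn 2 x) *
        h2
    simp only [e, ← ht]
    ring
  have hx0 : coord hn 0 x = t ^ 6 := by
    rw [← ht, hz] at h2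
    rw [hz] at h1
    -- For t = 0 the second equation carries no information on x_1, and the first gives x_1² = 0.
    by_cases h0 : t = 0
    · subst h0
      simpa using h1
    · have : t ^ 4 * (coord hn 0 x - t ^ 6) = 0 := by linear_combination -h2
      rcases mul_eq_zero.1 this with h | h
      · exact absurd h (pow_ne_zero 4 h0)
      · linarith
  refine ⟨t, space_ext hn (fun a => ?_) fun i hi => ?_⟩
  · fin_cases a
    · simp [hx0]
    · simp [ht]
    · simp [hz]
  · rw [h3 i hi, curve_apply_of_three_le hn t hi]

theorem curve_mem (t : ℝ) : curve hn t ∈ W8 hn := by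
  refine ⟨?_, ?_, fun i hi => curve_apply_of_three_le hn t hi⟩ <;> simp <;> ring

/-- The derivative of the parametrization `curve`. -/
def curveDeriv (t : ℝ) : Space n :=
  Pi.single (idx hn 0) (6 * t ^ 5 : ℝ) + Pi.single (idx hn 1) (5 * t ^ 4 : ℝ)
    + Pi.single (idx hn 2) (-(4 * t ^ 3) : ℝ)

theorem hasDerivAt_curve (t : ℝ) : HasDerivAt (curve hn) (curveDeriv hn t) t := by
  have hs : ∀ (a : Fin 3) {f : ℝ → ℝ} {f' : ℝ}, HasDerivAt f f' t →
      HasDerivAt (fun t => (Pi.single (idx hn a) (f t) : Space n)) (Pi.single (idx hn a) f') t :=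
    fun a f f' h =>
      (ContinuousLinearMap.single ℝ (fun _ : Fin (2 * n) => ℝ) (idx hn a)).hasFDerivAt
        |>.comp_hasDerivAt t h
  refine ((hs 0 ?_).add (hs 1 ?_)).add (hs 2 ?_)
  · simpa using hasDerivAt_pow 6 t
  · simpa using hasDerivAt_pow 5 t
  · have h := (hasDerivAt_pow 4 t).fun_neg
    exact_mod_cast h

theorem euler_curve (t : ℝ) : euler hn (curve hn t) = t • curveDeriv hn t := by
  simp only [euler, curveDeriv, smul_add, ← Pi.single_smul, smul_eq_mul, coord_zero_curve,
    coord_one_curve, coord_two_curve]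
  ring_nf

/-- Along the curve `f` is identically 0, so its derivative kills the velocity, and each X_i is a
multiple of the velocity at points of `W8`. Vector-valued `f` are allowed so that the coefficients
of a form can be treated all at once. -/
theorem vanishesOn_fderiv_vectorField (i : Fin 8) {F : Type} [NormedAddCommGroup F]
    [NormedSpace ℝ F] {f : Space n → F} (hf : SmoothNearZero f) (hN : VanishesOn (W8 hn) f) :
    VanishesOn (W8 hn) fun x => fderiv ℝ f x ((vectorField hn i).1 x) := by
  filter_upwards [hf, hN.eventually_nhds] with x h1 h2 hx
  obtain ⟨t, rfl⟩ := exists_curve_eq hn hx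
  have h3 := (h1.differentiableAt (by simp)).hasFDerivAt.comp_hasDerivAt t (hasDerivAt_curve hn t)
  have h4 : f ∘ curve hn =ᶠ[𝓝 t] fun _ => 0 := by
    filter_upwards [(hasDerivAt_curve hn t).continuousAt.eventually h2] with s hs
    exact hs (curve_mem hn s)
  have h5 := h3.unique ((hasDerivAt_const t (0 : F)).congr_of_eventuallyEq h4)
  simp only [vectorField, euler_curve, map_smul, h5, smul_zero]

theorem isTangentTo_vectorField (i : Fin 8) : IsTangentTo (vectorField hn i) (W8 hn) :=
  fun _ hf hN => vanishesOn_fderiv_vectorField hn i hf hN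

/-- The contraction of `θ_{j+1}` with the Euler vector field. -/
def eulerTheta (j : Fin 8) : FormField (Space n) 1 := interiorProd (euler hn) (thetaField hn j)

theorem contDiff_monomial (i : Fin 8) : ContDiff ℝ ∞ (monomial hn i) := by
  have h0 := coord_contDiff hn 0
  have h1 := coord_contDiff hn 1
  have h2 := coord_contDiff hn 2
  fin_cases i <;> simp [monomial] <;> fun_prop

theorem contDiff_thetaField (j : Fin 8) : ContDiff ℝ ∞ (thetaField hn j) := by
  have h0 := coord_contDiff hn 0
  have h1 := coord_contDiff hn 1
  have h2 := coord_contDiff hn 2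
  fin_cases j <;> simp [thetaField] <;> fun_prop

theorem contDiff_euler : ContDiff ℝ ∞ (euler hn) := by
  have hs : ∀ a : Fin 3, ContDiff ℝ ∞ (fun r : ℝ => (Pi.single (idx hn a) r : Space n)) :=
    fun a => (ContinuousLinearMap.single ℝ (fun _ : Fin (2 * n) => ℝ) (idx hn a)).contDiff
  unfold euler
  exact (((hs 0).comp (contDiff_const.mul (coord_contDiff hn 0))).add
    ((hs 1).comp (contDiff_const.mul (coord_contDiff hn 1)))).add
    ((hs 2).comp (contDiff_const.mul (coord_contDiff hn 2)))

theorem contDiff_eulerTheta (j : Fin 8) : ContDiff ℝ ∞ (eulerTheta hn j) :=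
  contDiff_iff_contDiffAt.2 fun _ =>
    interiorProd_contDiffAt (contDiff_euler hn).contDiffAt (contDiff_thetaField hn j).contDiffAt

/-- The first equation of `W_8`. -/
def eqn₁ (x : Space n) : ℝ := coord hn 0 x ^ 2 + coord hn 2 x ^ 3

/-- The second equation of `W_8`. -/
def eqn₂ (x : Space n) : ℝ := coord hn 1 x ^ 2 + coord hn 0 x * coord hn 2 x

theorem contDiff_eqn₁ : ContDiff ℝ ∞ (eqn₁ hn) :=
  ((coord_contDiff hn 0).pow 2).add ((coord_contDiff hn 2).pow 3)

theorem contDiff_eqn₂ : ContDiff ℝ ∞ (eqn₂ hn) :=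
  ((coord_contDiff hn 1).pow 2).add ((coord_contDiff hn 0).mul (coord_contDiff hn 2))

theorem hasFDerivAt_coord (a : Fin 3) (x : Space n) :
    HasFDerivAt (coord hn a) (ContinuousLinearMap.proj (R := ℝ) (φ := fun _ : Fin (2 * n) => ℝ)
      (idx hn a)) x :=
  (ContinuousLinearMap.proj (R := ℝ) (φ := fun _ : Fin (2 * n) => ℝ) (idx hn a)).hasFDerivAt

theorem fderiv_eqn₁ (x v : Space n) : fderiv ℝ (eqn₁ hn) x v =
    2 * coord hn 0 x * coord hn 0 v + 3 * coord hn 2 x ^ 2 * coord hn 2 v := by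
  have h := ((hasFDerivAt_coord hn 0 x).pow 2).add ((hasFDerivAt_coord hn 2 x).pow 3)
  have e : fderiv ℝ (eqn₁ hn) x = _ := h.fderiv
  rw [e]
  simp [coord]

theorem fderiv_eqn₂ (x v : Space n) : fderiv ℝ (eqn₂ hn) x v =
    2 * coord hn 1 x * coord hn 1 v + coord hn 0 x * coord hn 2 v
      + coord hn 2 x * coord hn 0 v := by
  have h := ((hasFDerivAt_coord hn 1 x).pow 2).add
    ((hasFDerivAt_coord hn 0 x).mul (hasFDerivAt_coord hn 2 x))
  have e : fderiv ℝ (eqn₂ hn) x = _ := h.fderiv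
  rw [e]
  simp [coord]
  ring

@[simp]
theorem dxdx_apply (a b : Fin 3) (u v : Space n) :
    dxdx hn a b ![u, v] = coord hn a u * coord hn b v - coord hn b u * coord hn a v := rfl

@[simp]
theorem coord_zero_euler (x : Space n) : coord hn 0 (euler hn x) = 6 * coord hn 0 x := by
  simp [euler]

@[simp]
theorem coord_one_euler (x : Space n) : coord hn 1 (euler hn x) = 5 * coord hn 1 x := by
  simp [euler]

@[simp]
theorem coord_two_euler (x : Space n) : coord hn 2 (euler hn x) = 4 * coord hn 2 x := by
  simp [euler]

theorem eulerTheta_apply (j : Fin 8) (x v : Space n) :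
    eulerTheta hn j x ![v] = thetaField hn j x ![euler hn x, v] := rfl

/-- The index `k` in the relation `x_i e_j = c e_k` between the contractions
`e_j` of the forms `θ_j`. -/
def relIdx : Fin 8 → Fin 8 → Fin 8 :=
  ![![0, 1, 2, 3, 4, 5, 6, 7],
    ![3, 4, 5, 6, 7, 7, 7, 7],
    ![4, 5, 7, 7, 7, 7, 7, 7],
    ![5, 7, 6, 7, 7, 7, 7, 7],
    ![6, 7, 7, 7, 7, 7, 7, 7],
    ![7, 7, 7, 7, 7, 7, 7, 7],
    ![7, 7, 7, 7, 7, 7, 7, 7],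
    ![7, 7, 7, 7, 7, 7, 7, 7]]

/-- The coefficient `c` in the relation `x_i e_j = c e_k` between the contractions
`e_j` of the forms `θ_j`. -/
def relCoef : Fin 8 → Fin 8 → ℝ :=
  ![![1, 1, 1, 1, 1, 1, 1, 1],
    ![1, -2, 1 / 3, 1, 0, -3, 0, 0],
    ![1, 2 / 3, 0, 0, 1, 0, 0, 0],
    ![1 / 3, 0, 3 / 2, -1, 0, 0, 0, 0],
    ![1, 0, -1, 0, 0, 0, 0, 0],
    ![0, -2, 0, 0, 0, 0, 0, 0],
    ![1, 0, 0, 0, 0, 0, 0, 0],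
    ![-1, 0, 0, 0, 0, 0, 0, 0]]

/-- The coefficient of the differential of the first equation in the relation between `x_i e_j`
and the contractions. -/
def relCoef₁ (i j : Fin 8) (x y z : ℝ) : ℝ :=
  (![![0, 0, 0, 0, 0, 0, 0, 0],
      ![0, 0, 0, 0, -x, 0, y * z, -(x * y)],
      ![0, 0, z, -x, 0, 3 * z ^ 2, y ^ 2, -(z ^ 3)],
      ![0, -2 * z, -5 / 2 * y, 0, z ^ 2, -3 * y * z, x * y, y * z ^ 2],
      ![0, 2 * x, 0, y * z, y ^ 2, 3 * x * y, y * z ^ 2, y ^ 3],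
      ![-x, 0, z ^ 2, y ^ 2, -(x * y), 3 * z ^ 3, y ^ 2 * z, -(z ^ 4)],
      ![0, 2 * z ^ 2, y * z, -(x * y), -(z ^ 3), 3 * y * z ^ 2, y ^ 3, -(y * z ^ 3)],
      ![0, -2 * z ^ 2, -(y * z), x * y, z ^ 3, -3 * y * z ^ 2, -(y ^ 3), y * z ^ 3]] :
    Fin 8 → Fin 8 → ℝ) i j

/-- The coefficient of the differential of the second equation in the relation between `x_i e_j`
and the contractions. -/
def relCoef₂ (i j : Fin 8) (x y z : ℝ) : ℝ :=
  (![![0, 0, 0, 0, 0, 0, 0, 0],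
      ![0, -4 * z, -11 / 3 * y, 0, -2 * z ^ 2, -4 * y * z, -2 * x * y, -2 * y * z ^ 2],
      ![0, -4 / 3 * y, 3 * x, -2 * z ^ 2, 0, 2 * y ^ 2, -2 * z ^ 3, -2 * y ^ 2 * z],
      ![4 / 3 * y, 0, 0, 0, 2 * y ^ 2, 2 * x * y, 2 * y * z ^ 2, 2 * y ^ 3],
      ![0, 0, -5 * y * z, -2 * x * y, -2 * z ^ 3, 2 * y * z ^ 2, 2 * y ^ 3, -2 * y * z ^ 3],
      ![-2 * z ^ 2, -4 * y * z, -3 * y ^ 2, -2 * z ^ 3, -2 * y * z ^ 2, 2 * y ^ 2 * z,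
        -2 * z ^ 4, -2 * y ^ 2 * z ^ 2],
      ![0, 0, 3 * x * y, -2 * y * z ^ 2, -2 * y ^ 2 * z, 2 * y ^ 3, -2 * y * z ^ 3,
        -2 * y ^ 3 * z],
      ![0, 0, -3 * x * y, 2 * y * z ^ 2, 2 * y ^ 2 * z, -2 * y ^ 3, 2 * y * z ^ 3, 2 * y ^ 3 * z]] :
    Fin 8 → Fin 8 → ℝ) i j

theorem contDiff_relCoef₁ (i j : Fin 8) : ContDiff ℝ ∞ fun x : Space n =>
    relCoef₁ i j (coord hn 0 x) (coord hn 1 x) (coord hn 2 x) := by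
  have h0 := coord_contDiff hn 0
  have h1 := coord_contDiff hn 1
  have h2 := coord_contDiff hn 2
  fin_cases i <;> fin_cases j <;> simp [relCoef₁] <;> fun_prop

theorem contDiff_relCoef₂ (i j : Fin 8) : ContDiff ℝ ∞ fun x : Space n =>
    relCoef₂ i j (coord hn 0 x) (coord hn 1 x) (coord hn 2 x) := by
  have h0 := coord_contDiff hn 0
  have h1 := coord_contDiff hn 1
  have h2 := coord_contDiff hn 2
  fin_cases i <;> fin_cases j <;> simp [relCoef₂] <;> fun_prop

set_option maxHeartbeats 2000000 in
-- All the 1-forms involved annihilate the velocity, so for t ≠ 0 they lie in the plane spanned by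
-- dH₁ and dH₂; the content is that the coefficients are polynomials in x_1, x_2, x_3. The target is
-- dictated by the weighted degree of m_i e_j: it is the form of that weight, and the coefficient is
-- 0 when no form has it, in which case `relIdx` is the filler 7.
theorem monomial_mul_eulerTheta_curve (i j : Fin 8) (t : ℝ) (v : Space n) :
    monomial hn i (curve hn t) * eulerTheta hn j (curve hn t) ![v] =
      relCoef i j * eulerTheta hn (relIdx i j) (curve hn t) ![v]
      + relCoef₁ i j (t ^ 6) (t ^ 5) (-t ^ 4) * fderiv ℝ (eqn₁ hn) (curve hn t) v
      + relCoef₂ i j (t ^ 6) (t ^ 5) (-t ^ 4) * fderiv ℝ (eqn₂ hn) (curve hn t) v := by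
  simp only [fderiv_eqn₁, fderiv_eqn₂, eulerTheta_apply, coord_zero_curve, coord_one_curve,
    coord_two_curve]
  fin_cases i <;> fin_cases j <;>
    simp [relCoef, relCoef₁, relCoef₂, relIdx, monomial, thetaField] <;>
    first | ring1 | exact Or.inl (by ring1)

end

/-! ### The action of the vector fields on the eight restrictions. -/

section

variable {n : ℕ} (hn : 2 ≤ n)

/-- The coefficients of `dx_2 ∧ dx_3`, `dx_1 ∧ dx_3`, `dx_1 ∧ dx_2` in `θ_{j+1}`. -/
def thetaCoef (j : Fin 8) (x : Space n) : Fin 3 → ℝ :=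
  ![(![1, 0, 0, coord hn 2 x, coord hn 1 x, coord hn 0 x, coord hn 2 x ^ 2, coord hn 1 x ^ 2] :
      Fin 8 → ℝ) j,
    (![0, 1, 0, 0, 0, coord hn 1 x, 0, 0] : Fin 8 → ℝ) j,
    (![0, 0, 1, 0, 0, 0, 0, 0] : Fin 8 → ℝ) j]

/-- The derivative of `thetaCoef` in the direction `u`. -/
def thetaCoefDeriv (j : Fin 8) (x u : Space n) : Fin 3 → ℝ :=
  ![(![0, 0, 0, coord hn 2 u, coord hn 1 u, coord hn 0 u, 2 * coord hn 2 x * coord hn 2 u,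
      2 * coord hn 1 x * coord hn 1 u] : Fin 8 → ℝ) j,
    (![0, 0, 0, 0, 0, coord hn 1 u, 0, 0] : Fin 8 → ℝ) j,
    0]

theorem thetaField_eq (j : Fin 8) (x : Space n) : thetaField hn j x =
    thetaCoef hn j x 0 • dxdx hn 1 2 + thetaCoef hn j x 1 • dxdx hn 0 2
      + thetaCoef hn j x 2 • dxdx hn 0 1 := by
  fin_cases j <;> simp [thetaField, thetaCoef]

theorem fderiv_thetaField_apply (j : Fin 8) (x u v w : Space n) :
    fderiv ℝ (thetaField hn j) x u ![v, w] =
      thetaCoefDeriv hn j x u 0 * dxdx hn 1 2 ![v, w]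
        + thetaCoefDeriv hn j x u 1 * dxdx hn 0 2 ![v, w]
        + thetaCoefDeriv hn j x u 2 * dxdx hn 0 1 ![v, w] := by
  rw [← hasFDerivAt_form_apply ((contDiff_thetaField hn j).differentiable (by simp) x)]
  have h1 := hasFDerivAt_coord hn 0 x
  have h2 := hasFDerivAt_coord hn 1 x
  have h3 := hasFDerivAt_coord hn 2 x
  have hc : ∀ c : ℝ, HasFDerivAt (fun _ : Space n => c) (0 : Space n →L[ℝ] ℝ) x := fun c =>
    hasFDerivAt_const c x
  have e : ∀ {f : Space n → ℝ} {f' : Space n →L[ℝ] ℝ} (c : ℝ), HasFDerivAt f f' x →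
      HasFDerivAt (fun y : Space n => f y * c) (c • f') x := by
    intro f f' c h
    exact h.mul_const c
  have key : ∀ {f : Space n → ℝ} {f' : Space n →L[ℝ] ℝ} {c : ℝ}, HasFDerivAt f f' x →
      f' u = c → fderiv ℝ f x u = c := by
    intro f f' c h h'
    rw [h.fderiv, h']
  fin_cases j
  · exact key (hc _) (by simp [thetaCoefDeriv])
  · exact key (hc _) (by simp [thetaCoefDeriv])
  · exact key (hc _) (by simp [thetaCoefDeriv])
  · exact key (e _ h3) (by simp [thetaCoefDeriv, coord]; ring)
  · exact key (e _ h2) (by simp [thetaCoefDeriv, coord]; ring)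
  · exact key ((e _ h1).add (e _ h2)) (by simp [thetaCoefDeriv, coord]; ring)
  · exact key (e _ (h3.pow 2)) (by simp [thetaCoefDeriv, coord]; ring)
  · exact key (e _ (h2.pow 2)) (by simp [thetaCoefDeriv, coord]; ring)

/-- Only θ_6 needs a cancellation: dx_1∧dx_2∧dx_3 + dx_2∧dx_1∧dx_3 = 0. In the others a differential
is repeated or the coefficients are constant. -/
theorem extDeriv_thetaField (j : Fin 8) : extDeriv (thetaField hn j) = 0 := by
  funext x
  ext v
  rw [show v = ![v 0, v 1, v 2] by ext i; fin_cases i <;> rfl, extDeriv_two_apply]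
  simp only [fderiv_thetaField_apply, dxdx_apply]
  fin_cases j <;> simp [thetaCoefDeriv] <;> ring

/-- The Euler vector field as a continuous linear map. -/
def eulerL : Space n →L[ℝ] Space n :=
  LinearMap.toContinuousLinearMap
    { toFun := euler hn
      map_add' := fun x y => by
        simp only [euler, coord_add, mul_add, Pi.single_add]
        abel
      map_smul' := fun c x => by
        simp only [euler, coord_smul, RingHom.id_apply, smul_add, ← Pi.single_smul, smul_eq_mul]
        ring_nf }

theorem fderiv_euler (x u : Space n) : fderiv ℝ (euler hn) x u = euler hn u := by
  have h : HasFDerivAt (euler hn) (eulerL hn) x := (eulerL hn).hasFDerivAt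
  rw [h.fderiv]
  rfl

/-- The quasi-homogeneous degrees of the forms `θ_j`. -/
def weight : Fin 8 → ℝ := ![9, 10, 11, 13, 14, 15, 17, 19]

/-- This is L_E θ_j = w_j θ_j for a closed quasi-homogeneous form. -/
theorem extDeriv_eulerTheta (j : Fin 8) (x : Space n) :
    extDeriv (eulerTheta hn j) x = weight j • thetaField hn j x := by
  apply form_two_ext
  intro u v
  have key : ∀ u v, fderiv ℝ (eulerTheta hn j) x u ![v] =
      thetaField hn j x ![euler hn u, v] + fderiv ℝ (thetaField hn j) x u ![euler hn x, v] := by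
    intro u v
    rw [eulerTheta, fderiv_interiorProd ((contDiff_euler hn).differentiable (by simp) x)
      ((contDiff_thetaField hn j).differentiable (by simp) x), fderiv_euler]
    rfl
  rw [extDeriv_one_apply, key, key, thetaField_eq]
  simp only [ContinuousAlternatingMap.add_apply, ContinuousAlternatingMap.smul_apply,
    fderiv_thetaField_apply, dxdx_apply, coord_zero_euler, coord_one_euler, coord_two_euler,
    smul_eq_mul]
  fin_cases j <;> simp [thetaCoefDeriv, thetaCoef, weight] <;> ring

theorem hasDRestriction_eulerTheta (j : Fin 8) : HasDRestriction (W8 hn) (eulerTheta hn j)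
    (weight j • algRestriction (W8 hn) (theta hn j)) := by
  refine ⟨(contDiff_eulerTheta hn j).smoothNearZero, ?_⟩
  rw [← map_smul]
  exact algRestriction_congr (Eventually.of_forall fun x => extDeriv_eulerTheta hn j x)

theorem eqn₁_eq_zero {x : Space n} (hx : x ∈ W8 hn) : eqn₁ hn x = 0 := hx.1

theorem eqn₂_eq_zero {x : Space n} (hx : x ∈ W8 hn) : eqn₂ hn x = 0 := hx.2.1

/-- The working criterion: pointwise identities on `W8`, modulo the differentials of the equations,
determine [dη]. -/
theorem HasDRestriction.of_eqOn {η η' : FormField (Space n) 1} {c : AlgRestriction (W8 hn) 1}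
    (h : HasDRestriction (W8 hn) η c) (hη' : ContDiff ℝ ∞ η') {a b : Space n → ℝ}
    (ha : ContDiff ℝ ∞ a) (hb : ContDiff ℝ ∞ b)
    (hN : ∀ x ∈ W8 hn, ∀ v, η' x ![v] =
      η x ![v] + a x * fderiv ℝ (eqn₁ hn) x v + b x * fderiv ℝ (eqn₂ hn) x v) :
    HasDRestriction (W8 hn) η' c := by
  have h1 := HasDRestriction.smul_fderiv ha (contDiff_eqn₁ hn) fun x hx => eqn₁_eq_zero hn hx
  have h2 := HasDRestriction.smul_fderiv hb (contDiff_eqn₂ hn) fun x hx => eqn₂_eq_zero hn hx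
  have h3 := (h.add h1).add h2
  rw [add_zero, add_zero] at h3
  refine h3.congr hη'.smoothNearZero (Eventually.of_forall fun x hx => form_one_ext fun v => ?_)
  simp [hN x hx v]

theorem monomial_mul_eulerTheta (i j : Fin 8) {x : Space n} (hx : x ∈ W8 hn) (v : Space n) :
    monomial hn i x * eulerTheta hn j x ![v] =
      relCoef i j * eulerTheta hn (relIdx i j) x ![v]
      + relCoef₁ i j (coord hn 0 x) (coord hn 1 x) (coord hn 2 x) * fderiv ℝ (eqn₁ hn) x v
      + relCoef₂ i j (coord hn 0 x) (coord hn 1 x) (coord hn 2 x) * fderiv ℝ (eqn₂ hn) x v := by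
  obtain ⟨t, rfl⟩ := exists_curve_eq hn hx
  simpa using monomial_mul_eulerTheta_curve hn i j t v

theorem hasDRestriction_monomial_smul_eulerTheta (i j : Fin 8) :
    HasDRestriction (W8 hn) (fun x => monomial hn i x • eulerTheta hn j x)
      ((relCoef i j * weight (relIdx i j)) • algRestriction (W8 hn) (theta hn (relIdx i j))) := by
  have h := (hasDRestriction_eulerTheta hn (relIdx i j)).const_smul (relCoef i j)
  rw [smul_smul] at h
  refine h.of_eqOn hn ((contDiff_monomial hn i).smul (contDiff_eulerTheta hn j))
    (contDiff_relCoef₁ hn i j) (contDiff_relCoef₂ hn i j) fun x hx v => ?_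
  exact monomial_mul_eulerTheta hn i j hx v

theorem algRestriction_lieDeriv_theta (i j : Fin 8) :
    algRestriction (W8 hn) (lieDeriv (vectorField hn i) (theta hn j)) =
      (relCoef i j * weight (relIdx i j)) • algRestriction (W8 hn) (theta hn (relIdx i j)) := by
  have h : HasDRestriction (W8 hn) _ _ := extDeriv_interiorProd_hasDRestriction
    (X := vectorField hn i) (η := theta hn j)
    (Eventually.of_forall fun x => congrFun (extDeriv_thetaField hn j) x)
  obtain ⟨hs, h1⟩ := h
  obtain ⟨hs', h2⟩ := hasDRestriction_monomial_smul_eulerTheta hn i j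
  rw [← h1, ← h2]
  refine algRestriction_congr (Filter.EventuallyEq.extDeriv (Eventually.of_forall fun x => ?_))
  exact map_smul ((thetaField hn j x).curryLeft) _ _

/-- The action of the vector field `X_i` on algebraic restrictions. -/
def lieEnd (i : Fin 8) : Module.End ℝ (AlgRestriction (W8 hn) 1) :=
  (zeroRestriction (W8 hn) 1).liftQ
    { toFun := fun η => algRestriction (W8 hn) (lieDeriv (vectorField hn i) η)
      map_add' := fun η η' => by
        rw [← map_add]
        apply algRestriction_congr
        have hη : SmoothNearZero η.1 := η.2
        have hη' : SmoothNearZero η'.1 := η'.2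
        have hX : SmoothNearZero (vectorField hn i).1 := (vectorField hn i).2
        filter_upwards [hη, hη', hX] with x h1 h2 h3
        have e1 := extDeriv_add (h1.differentiableAt (by simp)) (h2.differentiableAt (by simp))
        have e2 := extDeriv_add
          ((interiorProd_contDiffAt h3 h1).differentiableAt (by simp))
          ((interiorProd_contDiffAt h3 h2).differentiableAt (by simp))
        have e3 : interiorProd (vectorField hn i).1 (η.1 + η'.1) =
          interiorProd (vectorField hn i).1 η.1 + interiorProd (vectorField hn i).1 η'.1 := rfl
        simp only [lieDeriv, Submodule.coe_add, Pi.add_apply]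
        rw [e3, e2]
        rw [interiorProd, e1]
        simp only [interiorProd, ContinuousAlternatingMap.curryLeft_add, add_apply]
        abel
      map_smul' := fun c η => by
        rw [RingHom.id_apply, ← map_smul]
        refine algRestriction_congr (Eventually.of_forall fun x => ?_)
        have e1 : interiorProd (vectorField hn i).1 (c • η.1) =
          c • interiorProd (vectorField hn i).1 η.1 := rfl
        have e2 := extDeriv_smul (x := x) c η.1
        simp only [lieDeriv, Submodule.coe_smul, Pi.smul_apply, smul_add]
        rw [e1, extDeriv_smul, interiorProd, e2]
        rfl }
    (fun η hη => by
      rw [LinearMap.mem_ker]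
      exact (Submodule.Quotient.mk_eq_zero _).2 (lieDeriv_mem_zeroRestriction
        (fun F _ _ f hf hN => vanishesOn_fderiv_vectorField hn i hf hN) hη))

theorem lieEnd_algRestriction (i : Fin 8) (η : smoothForms (Space n) 2) :
    lieEnd hn i (algRestriction (W8 hn) η) =
      algRestriction (W8 hn) (lieDeriv (vectorField hn i) η) := rfl

end

/-! ### Smooth multiples of the contracted forms; primitives along quasi-homogeneous dilations. -/

section

variable {n : ℕ} (hn : 2 ≤ n)

/-- The span of the algebraic restrictions of `θ_1, …, θ_8`. -/
def thetaSpan : Submodule ℝ (AlgRestriction (W8 hn) 1) :=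
  Submodule.span ℝ (Set.range fun j => algRestriction (W8 hn) (theta hn j))

theorem theta_mem_thetaSpan (j : Fin 8) : algRestriction (W8 hn) (theta hn j) ∈ thetaSpan hn :=
  Submodule.subset_span ⟨j, rfl⟩

theorem sum_eq_sum_idx {F : Fin (2 * n) → ℝ} (h : ∀ i, 3 ≤ i.val → F i = 0) :
    ∑ i, F i = ∑ a, F (idx hn a) := by
  symm
  refine Fintype.sum_of_injective (idx hn) (idx_injective hn) _ _ (fun i hi => h i ?_)
    fun _ => rfl
  by_contra h3
  exact hi ⟨⟨i.val, not_le.1 h3⟩, rfl⟩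

/-- The number of the coordinate `x_{a+1}` among the monomials. -/
def coordIdx : Fin 3 → Fin 8 := ![3, 2, 1]

theorem monomial_coordIdx (a : Fin 3) : monomial hn (coordIdx a) = coord hn a := by
  fin_cases a <;> rfl

/-- Multiplication by a coordinate raises the weighted degree, and the weights increase with the
index; this makes the descending induction terminate. -/
theorem relCoef_eq_zero_or_lt (a : Fin 3) (j : Fin 8) :
    relCoef (coordIdx a) j = 0 ∨ j < relIdx (coordIdx a) j := by
  fin_cases a <;> fin_cases j <;> simp [relCoef, relIdx, coordIdx]

theorem exists_hasDRestriction_smul_eulerTheta_aux (m : ℕ) : ∀ j : Fin 8, 8 ≤ j.val + m →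
    ∀ f : Space n → ℝ, ContDiff ℝ ∞ f →
      ∃ c ∈ thetaSpan hn, HasDRestriction (W8 hn) (fun x => f x • eulerTheta hn j x) c := by
  induction m with
  -- Vacuous, since there is no index j ≥ 8.
  | zero => intro j hj; omega
  | succ m ih =>
    intro j hj f hf
    obtain ⟨g, hg, hfg⟩ := exists_hadamard hf
    have h1 : ∀ a : Fin 3, ∃ c ∈ thetaSpan hn, HasDRestriction (W8 hn)
        (fun x => (relCoef (coordIdx a) j * g (idx hn a) x) •
          eulerTheta hn (relIdx (coordIdx a) j) x) c := by
      intro a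
      rcases relCoef_eq_zero_or_lt a j with h0 | h0
      · refine ⟨0, Submodule.zero_mem _, ?_⟩
        simp only [h0, zero_mul, zero_smul]
        exact HasDRestriction.zero
      · exact ih _ (by rw [Fin.lt_def] at h0; omega) _ (contDiff_const.mul (hg _))
    choose c hc hcd using h1
    refine ⟨f 0 • weight j • algRestriction (W8 hn) (theta hn j) + ∑ a, c a,
      add_mem (Submodule.smul_mem _ _ (Submodule.smul_mem _ _ (theta_mem_thetaSpan hn j)))
        (sum_mem fun a _ => hc a), ?_⟩
    refine (((hasDRestriction_eulerTheta hn j).const_smul (f 0)).add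
      (HasDRestriction.sum Finset.univ fun a _ => hcd a)).of_eqOn hn
      (hf.smul (contDiff_eulerTheta hn j))
      (a := fun x => ∑ a, g (idx hn a) x *
        relCoef₁ (coordIdx a) j (coord hn 0 x) (coord hn 1 x) (coord hn 2 x))
      (b := fun x => ∑ a, g (idx hn a) x *
        relCoef₂ (coordIdx a) j (coord hn 0 x) (coord hn 1 x) (coord hn 2 x))
      (ContDiff.sum fun a _ => (hg _).mul (contDiff_relCoef₁ hn _ _))
      (ContDiff.sum fun a _ => (hg _).mul (contDiff_relCoef₂ hn _ _)) fun x hx v => ?_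
    -- On `W8` the Hadamard terms of the coordinates beyond the third drop out.
    have h2 : f x = f 0 + ∑ a, coord hn a x * g (idx hn a) x := by
      rw [hfg x, sum_eq_sum_idx hn fun i hi => by rw [hx.2.2 i hi, zero_mul]]
      rfl
    have h3 : ∀ a : Fin 3, _ := fun a => monomial_mul_eulerTheta hn (coordIdx a) j hx v
    simp only [monomial_coordIdx] at h3
    simp only [Pi.add_apply, Pi.smul_apply, ContinuousAlternatingMap.add_apply,
      ContinuousAlternatingMap.smul_apply, smul_eq_mul, Fin.sum_univ_three, h2]
    linear_combination g (idx hn 0) x * h3 0 + g (idx hn 1) x * h3 1 + g (idx hn 2) x * h3 2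

theorem exists_hasDRestriction_smul_eulerTheta (j : Fin 8) {f : Space n → ℝ}
    (hf : ContDiff ℝ ∞ f) :
    ∃ c ∈ thetaSpan hn, HasDRestriction (W8 hn) (fun x => f x • eulerTheta hn j x) c :=
  exists_hasDRestriction_smul_eulerTheta_aux hn 8 j (by omega) f hf

/-- The bilinear form underlying a `2`-form. -/
def bilin {E : Type} [NormedAddCommGroup E] [NormedSpace ℝ E] (σ : E [⋀^Fin 2]→L[ℝ] ℝ) :
    E →L[ℝ] E →L[ℝ] ℝ :=
  ((ContinuousAlternatingMap.ofSubsingletonLIE (𝕜 := ℝ) (E := E) (F := ℝ)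
    (0 : Fin 1)).symm.toContinuousLinearEquiv : (E [⋀^Fin 1]→L[ℝ] ℝ) →L[ℝ] E →L[ℝ] ℝ).comp
    σ.curryLeft

theorem bilin_apply {E : Type} [NormedAddCommGroup E] [NormedSpace ℝ E] (σ : E [⋀^Fin 2]→L[ℝ] ℝ)
    (u v : E) : bilin σ u v = σ ![u, v] := by
  change σ _ = _
  congr 1
  ext i
  fin_cases i <;> rfl

theorem contDiff_bilin {E : Type} [NormedAddCommGroup E] [NormedSpace ℝ E]
    [FiniteDimensional ℝ E] {σ : FormField E 2} (hσ : ContDiff ℝ ∞ σ) :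
    ContDiff ℝ ∞ fun x => bilin (σ x) := by
  refine contDiff_clm_apply_iff.2 fun u => contDiff_clm_apply_iff.2 fun v => ?_
  simp only [bilin_apply]
  exact (ContinuousAlternatingMap.apply ℝ E ℝ ![u, v]).contDiff.comp hσ

theorem fderiv_bilin {E : Type} [NormedAddCommGroup E] [NormedSpace ℝ E]
    [FiniteDimensional ℝ E] {σ : FormField E 2} (hσ : ContDiff ℝ ∞ σ) (x u v w : E) :
    fderiv ℝ (fun x => bilin (σ x)) x u v w = fderiv ℝ σ x u ![v, w] := by
  rw [← hasFDerivAt_form_apply (hσ.differentiable (by simp) x)]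
  simp only [← bilin_apply]
  have h := (((contDiff_bilin hσ).differentiable (by simp) x).hasFDerivAt.clm_apply
    (hasFDerivAt_const v x)).clm_apply (hasFDerivAt_const w x)
  rw [h.fderiv]
  simp

/-- The weight of the `i`-th coordinate. -/
def wt (i : Fin (2 * n)) : ℕ :=
  if i.val = 0 then 6 else if i.val = 1 then 5 else if i.val = 2 then 4 else 1

theorem one_le_wt (i : Fin (2 * n)) : 1 ≤ wt i := by
  unfold wt
  split_ifs <;> norm_num

/-- The quasi-homogeneous contraction of the space. -/
def dilation (s : ℝ) : Space n →L[ℝ] Space n :=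
  ContinuousLinearMap.pi fun i => s ^ wt i • ContinuousLinearMap.proj i

@[simp]
theorem dilation_apply (s : ℝ) (x : Space n) (i : Fin (2 * n)) :
    dilation s x i = s ^ wt i * x i := rfl

theorem contDiff_dilation : ContDiff ℝ ∞ (dilation : ℝ → Space n →L[ℝ] Space n) := by
  refine contDiff_clm_apply_iff.2 fun x => contDiff_pi.2 fun i => ?_
  simp only [dilation_apply]
  fun_prop

theorem deriv_dilation_apply (s : ℝ) (x : Space n) (i : Fin (2 * n)) :
    deriv dilation s x i = wt i * s ^ (wt i - 1) * x i := by
  have h1 : HasDerivAt (fun s => dilation s x) (deriv dilation s x) s := by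
    simpa using ((contDiff_dilation (n := n)).differentiable (by simp) s).hasDerivAt.clm_apply
      (hasDerivAt_const s x)
  have h2 := hasDerivAt_pi.1 h1 i
  have h3 : HasDerivAt (fun s => dilation s x i) (wt i * s ^ (wt i - 1) * x i) s :=
    (hasDerivAt_pow (wt i) s).mul_const (x i)
  exact h2.unique h3

theorem norm_dilation_le {s : ℝ} (hs : s ∈ Set.Icc (0 : ℝ) 1) (x : Space n) :
    ‖dilation s x‖ ≤ ‖x‖ := by
  refine (pi_norm_le_iff_of_nonneg (norm_nonneg x)).2 fun i => ?_
  rw [dilation_apply, norm_mul]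
  have h : ‖s ^ wt i‖ ≤ 1 := by
    rw [Real.norm_of_nonneg (pow_nonneg hs.1 _)]
    exact pow_le_one₀ hs.1 hs.2
  calc _ ≤ 1 * ‖x i‖ := by gcongr
    _ ≤ ‖x‖ := by rw [one_mul]; exact norm_le_pi_norm x i

/-- The coefficients of the primitive of a closed `2`-form. -/
def primitiveCoef (B : Space n → Space n →L[ℝ] Space n →L[ℝ] ℝ) (a b : Fin (2 * n))
    (x : Space n) : ℝ :=
  ∫ s in (0 : ℝ)..1, s ^ (wt a + wt b - 1) * B (dilation s x) (Pi.single a 1) (Pi.single b 1)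

theorem contDiff_primitiveCoef_integrand {B : Space n → Space n →L[ℝ] Space n →L[ℝ] ℝ}
    (hB : ContDiff ℝ ∞ B) (a b : Fin (2 * n)) : ContDiff ℝ ∞ fun p : ℝ × Space n =>
      p.1 ^ (wt a + wt b - 1) * B (dilation p.1 p.2) (Pi.single a 1) (Pi.single b 1) :=
  (contDiff_fst.pow _).mul (((hB.comp ((contDiff_dilation.comp contDiff_fst).clm_apply
    contDiff_snd)).clm_apply contDiff_const).clm_apply contDiff_const)

theorem contDiff_primitiveCoef {B : Space n → Space n →L[ℝ] Space n →L[ℝ] ℝ}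
    (hB : ContDiff ℝ ∞ B) (a b : Fin (2 * n)) : ContDiff ℝ ∞ (primitiveCoef B a b) :=
  contDiff_integral (contDiff_primitiveCoef_integrand hB a b)

theorem primitiveCoef_swap {B : Space n → Space n →L[ℝ] Space n →L[ℝ] ℝ}
    (hanti : ∀ x u v, B x u v = -B x v u) (a b : Fin (2 * n)) (x : Space n) :
    primitiveCoef B a b x = -primitiveCoef B b a x := by
  rw [primitiveCoef, primitiveCoef, ← intervalIntegral.integral_neg]
  congr 1
  funext s
  rw [hanti, add_comm (wt a)]
  ring

theorem integral_eq_sum_primitiveCoef {B : Space n → Space n →L[ℝ] Space n →L[ℝ] ℝ}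
    (hB : ContDiff ℝ ∞ B) (x v : Space n) :
    ∫ s in (0 : ℝ)..1, B (dilation s x) (deriv dilation s x) (dilation s v) =
      ∑ b, v b * ∑ a, wt a * x a * primitiveCoef B a b x := by
  have h1 : ∀ s : ℝ, B (dilation s x) (deriv dilation s x) (dilation s v) =
      ∑ b, ∑ a, (v b * (wt a * x a)) *
        (s ^ (wt a + wt b - 1) * B (dilation s x) (Pi.single a 1) (Pi.single b 1)) := by
    intro s
    rw [clm_apply_eq_sum _ (dilation s v)]
    refine Finset.sum_congr rfl fun b _ => ?_
    rw [clm_apply_eq_sum _ (deriv dilation s x), sum_apply, Finset.smul_sum]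
    refine Finset.sum_congr rfl fun a _ => ?_
    -- The factor s^(wt a − 1) comes from the derivative of the dilation and s^(wt b) from the
    -- dilation of `v`; weights are at least 1, so the truncated subtraction is exact.
    have e : s ^ (wt a + wt b - 1) = s ^ (wt a - 1) * s ^ wt b := by
      rw [← pow_add]
      congr 1
      have := one_le_wt a
      omega
    rw [e, deriv_dilation_apply, dilation_apply, smul_apply]
    simp only [smul_eq_mul]
    ring
  have hc : ∀ a b, Continuous fun s : ℝ => (v b * (wt a * x a)) *
      (s ^ (wt a + wt b - 1) * B (dilation s x) (Pi.single a 1) (Pi.single b 1)) := fun a b =>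
    continuous_const.mul ((contDiff_primitiveCoef_integrand hB a b).continuous.comp
      (Continuous.prodMk_left x))
  have hI : ∀ b ∈ Finset.univ, IntervalIntegrable (fun s : ℝ => ∑ a, (v b * (wt a * x a)) *
      (s ^ (wt a + wt b - 1) * B (dilation s x) (Pi.single a 1) (Pi.single b 1)))
      MeasureTheory.volume 0 1 := fun b _ =>
    (continuous_finsetSum _ fun a _ => hc a b).intervalIntegrable _ _
  simp_rw [h1]
  rw [intervalIntegral.integral_finsetSum hI]
  refine Finset.sum_congr rfl fun b _ => ?_
  rw [intervalIntegral.integral_finsetSum fun a _ => (hc a b).intervalIntegrable _ _, Finset.mul_sum]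
  refine Finset.sum_congr rfl fun a _ => ?_
  rw [intervalIntegral.integral_const_mul, primitiveCoef]
  ring

end

/-! ### The eight restrictions span the closed ones. -/

section

variable {n : ℕ} (hn : 2 ≤ n)

theorem algRestriction_mem_thetaSpan {σ : smoothForms (Space n) 2}
    (hσ : σ ∈ closedForms (Space n) 2) : algRestriction (W8 hn) σ ∈ thetaSpan hn := by
  have hs : SmoothNearZero σ.1 := σ.2
  obtain ⟨τ, hτ, hτσ⟩ := hs.exists_contDiff
  have hcl : ∀ᶠ x in 𝓝 (0 : Space n), extDeriv τ x = 0 := by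
    have h : ∀ᶠ x in 𝓝 (0 : Space n), extDeriv σ.1 x = 0 := hσ
    filter_upwards [h, hτσ.extDeriv] with x h1 h2
    rw [h2, h1]
  obtain ⟨r, hr, hball⟩ := Metric.eventually_nhds_iff_ball.1 hcl
  have hanti : ∀ x u v, bilin (τ x) u v = -bilin (τ x) v u := fun x u v => by
    rw [bilin_apply, bilin_apply, form_two_swap]
  obtain ⟨η, hη, hdη, hint⟩ := exists_primitive_of_contraction (contDiff_bilin hτ) hanti (r := r)
    (fun x hx u v w => by
      have h := congrArg (fun ρ : Space n [⋀^Fin 3]→L[ℝ] ℝ => ρ ![u, v, w]) (hball x hx)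
      simp only [extDeriv_two_apply] at h
      simpa [fderiv_bilin hτ] using h)
    contDiff_dilation
    (by
      ext x i
      have := one_le_wt i
      simp [zero_pow (show wt i ≠ 0 by omega)])
    (by ext x i; simp) (fun s hs x => norm_dilation_le hs x)
  have hF := contDiff_primitiveCoef (contDiff_bilin hτ)
  set F := primitiveCoef fun x => bilin (τ x) with hFdef
  have hηF : ∀ x v, η x v = ∑ b, (∑ a, wt a * x a * F a b x) * v b := fun x v => by
    rw [hint, integral_eq_sum_primitiveCoef (contDiff_bilin hτ)]
    exact Finset.sum_congr rfl fun b _ => mul_comm _ _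
  have hswap : ∀ a b x, F a b x = -F b a x := fun a b x => primitiveCoef_swap hanti a b x
  -- Antisymmetry of `F` pairs the terms (a, b) and (b, a): F_ab (w_a x_a dx_b − w_b x_b dx_a) is
  -- F_ab times the contraction of dx_a∧dx_b with E. Hence θ_1, θ_2, θ_3 get the coefficients with
  -- index pairs (1, 2), (0, 2), (0, 1).
  obtain ⟨c₀, hc₀, h₀⟩ := exists_hasDRestriction_smul_eulerTheta hn 0 (hF (idx hn 1) (idx hn 2))
  obtain ⟨c₁, hc₁, h₁⟩ := exists_hasDRestriction_smul_eulerTheta hn 1 (hF (idx hn 0) (idx hn 2))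
  obtain ⟨c₂, hc₂, h₂⟩ := exists_hasDRestriction_smul_eulerTheta hn 2 (hF (idx hn 0) (idx hn 1))
  have hproj : ∀ b : Fin (2 * n), ContDiff ℝ ∞ fun x : Space n => x b := fun b =>
    contDiff_apply ℝ ℝ b
  have hH : ∀ b : Fin (2 * n), ContDiff ℝ ∞ fun x : Space n => ∑ a, wt a * x a * F a b x :=
    fun b => ContDiff.sum fun a _ => (contDiff_const.mul (hproj a)).mul (hF a b)
  -- The remaining components of the primitive are multiples of dx_b for coordinates that vanish on
  -- `W8`, so they contribute 0.
  have h₃ := HasDRestriction.sum (N := W8 hn) (c := fun _ => 0)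
    (Finset.univ.filter fun b : Fin (2 * n) => 3 ≤ b.val)
    (fun b hb => HasDRestriction.smul_fderiv (hH b) (hproj b) fun x hx =>
      hx.2.2 b (Finset.mem_filter.1 hb).2)
  have h₄ := ((h₀.add h₁).add h₂).add h₃
  rw [Finset.sum_const_zero, add_zero] at h₄
  have h₅ : HasDRestriction (W8 hn) (oneForm η) (c₀ + c₁ + c₂) := by
    refine h₄.congr (contDiff_oneForm hη).smoothNearZero (Eventually.of_forall fun x hx => ?_)
    apply form_one_ext
    intro v
    have hfd : ∀ b : Fin (2 * n), fderiv ℝ (fun x : Space n => x b) x v = v b := fun b => by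
      have h : HasFDerivAt (fun x : Space n => x b) (ContinuousLinearMap.proj (R := ℝ)
        (φ := fun _ : Fin (2 * n) => ℝ) b) x := (ContinuousLinearMap.proj (R := ℝ)
        (φ := fun _ : Fin (2 * n) => ℝ) b).hasFDerivAt
      rw [h.fderiv]
      rfl
    have hsum : ∀ b, ∑ a, wt a * x a * F a b x =
        ∑ a : Fin 3, wt (idx hn a) * x (idx hn a) * F (idx hn a) b x := fun b =>
      sum_eq_sum_idx hn fun i hi => by rw [hx.2.2 i hi]; ring
    have hlow : ∑ b with ¬ 3 ≤ b.val, (∑ a, wt a * x a * F a b x) * v b =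
        ∑ b : Fin 3, (∑ a, wt a * x a * F a (idx hn b) x) * v (idx hn b) := by
      rw [Finset.sum_filter, sum_eq_sum_idx hn fun i hi => if_neg (not_not.2 hi)]
      refine Finset.sum_congr rfl fun b _ => if_pos ?_
      simp only [idx, Fin.val_castLE]
      omega
    rw [oneForm_apply, hηF, ← Finset.sum_filter_add_sum_filter_not Finset.univ
      (fun b : Fin (2 * n) => 3 ≤ b.val), hlow]
    simp only [hsum, Pi.add_apply, Finset.sum_apply, ContinuousAlternatingMap.add_apply,
      ContinuousAlternatingMap.smul_apply, ContinuousAlternatingMap.sum_apply, oneForm_apply,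
      smul_apply, hfd, smul_eq_mul, Fin.sum_univ_three, eulerTheta_apply]
    have s₀ : ∀ b, F b b x = 0 := fun b => by linarith [hswap b b x]
    rw [s₀, s₀, s₀, hswap (idx hn 1) (idx hn 0), hswap (idx hn 2) (idx hn 0),
      hswap (idx hn 2) (idx hn 1)]
    have w0 : wt (idx hn 0) = 6 := rfl
    have w1 : wt (idx hn 1) = 5 := rfl
    have w2 : wt (idx hn 2) = 4 := rfl
    rw [w0, w1, w2]
    simp only [thetaField, Matrix.cons_val, dxdx_apply, coord_zero_euler, coord_one_euler,
      coord_two_euler]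
    simp only [coord, Nat.cast_ofNat]
    ring
  obtain ⟨hs5, h₆⟩ := h₅
  have h₇ : algRestriction (W8 hn) σ = c₀ + c₁ + c₂ := by
    rw [← h₆]
    apply algRestriction_congr
    filter_upwards [Metric.ball_mem_nhds 0 hr, hτσ] with x hx hx'
    rw [← hx']
    apply form_two_ext
    intro u v
    rw [extDeriv_one_apply, fderiv_oneForm (hη.differentiable (by simp) x),
      fderiv_oneForm (hη.differentiable (by simp) x), hdη x hx, bilin_apply]
  rw [h₇]
  exact add_mem (add_mem hc₀ hc₁) hc₂

theorem thetaSpan_eq : thetaSpan hn = closedRestrictions (W8 hn) 1 := by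
  apply le_antisymm
  · refine Submodule.span_le.2 ?_
    rintro _ ⟨j, rfl⟩
    exact ⟨theta hn j, Eventually.of_forall fun x => congrFun (extDeriv_thetaField hn j) x, rfl⟩
  · rintro _ ⟨σ, hσ, rfl⟩
    exact algRestriction_mem_thetaSpan hn hσ

end

/-! ### Taylor coefficients of functions vanishing on `W8`. -/

section

/-- Letting t → 0 kills the constant term; the punctured neighbourhood then permits division by t,
and induction applies. -/
theorem coeff_eq_zero_of_bound (N : ℕ) : ∀ a : Fin N → ℝ,
    (∃ C, ∀ᶠ t in 𝓝[≠] (0 : ℝ), |∑ k, a k * t ^ k.val| ≤ C * |t| ^ N) → ∀ k, a k = 0 := by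
  induction N with
  | zero => exact fun a _ k => k.elim0
  | succ N ih =>
    rintro a ⟨C, hC⟩
    have h0 : a 0 = 0 := by
      have h1 : Tendsto (fun t : ℝ => |∑ k, a k * t ^ k.val|) (𝓝[≠] 0) (𝓝 |a 0|) := by
        have hc : Continuous fun t : ℝ => |∑ k, a k * t ^ k.val| := by fun_prop
        have h2 := (hc.tendsto 0).mono_left (nhdsWithin_le_nhds (s := {0}ᶜ))
        simpa [Fin.sum_univ_succ] using h2
      have h3 : Tendsto (fun t : ℝ => C * |t| ^ (N + 1)) (𝓝[≠] 0) (𝓝 0) := by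
        have hc : Continuous fun t : ℝ => C * |t| ^ (N + 1) := by fun_prop
        have h2 := (hc.tendsto 0).mono_left (nhdsWithin_le_nhds (s := {0}ᶜ))
        simpa using h2
      have h4 := le_of_tendsto_of_tendsto h1 h3 hC
      exact abs_nonpos_iff.1 h4
    have h5 := ih (fun k => a k.succ) ⟨C, by
      filter_upwards [hC, self_mem_nhdsWithin] with t ht ht0
      have e : ∑ k, a k * t ^ k.val = t * ∑ k : Fin N, a k.succ * t ^ k.val := by
        rw [Fin.sum_univ_succ, h0, Finset.mul_sum]
        simp only [zero_mul, zero_add, Fin.val_succ]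
        exact Finset.sum_congr rfl fun k _ => by ring
      rw [e, abs_mul, pow_succ, ← mul_assoc, mul_comm _ |t|] at ht
      exact le_of_mul_le_mul_left ht (abs_pos.2 ht0)⟩
    intro k
    refine Fin.cases h0 h5 k

section Directional

variable {E : Type} [NormedAddCommGroup E] [NormedSpace ℝ E]

/-- The derivative of `f` in the constant direction `y`. -/
def dirDeriv (y : E) (f : E → ℝ) (x : E) : ℝ := fderiv ℝ f x y

theorem contDiff_dirDeriv {f : E → ℝ} (hf : ContDiff ℝ ∞ f) (y : E) :
    ContDiff ℝ ∞ (dirDeriv y f) :=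
  (hf.fderiv_right (m := ∞) le_rfl).clm_apply contDiff_const

theorem dirDeriv_congr {f g : E → ℝ} {x : E} (h : f =ᶠ[𝓝 x] g) (y : E) :
    dirDeriv y f =ᶠ[𝓝 x] dirDeriv y g := by
  filter_upwards [h.eventuallyEq_nhds] with z hz
  rw [dirDeriv, dirDeriv, hz.fderiv_eq]

theorem dirDeriv_add {f g : E → ℝ} (hf : ContDiff ℝ ∞ f) (hg : ContDiff ℝ ∞ g) (y : E) :
    dirDeriv y (f + g) = dirDeriv y f + dirDeriv y g := by
  funext x
  simp only [dirDeriv, Pi.add_apply]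
  rw [fderiv_add (hf.differentiable (by simp) x) (hg.differentiable (by simp) x)]
  rfl

theorem dirDeriv_sub {f g : E → ℝ} (hf : ContDiff ℝ ∞ f) (hg : ContDiff ℝ ∞ g) (y : E) :
    dirDeriv y (f - g) = dirDeriv y f - dirDeriv y g := by
  funext x
  simp only [dirDeriv, Pi.sub_apply]
  rw [fderiv_sub (hf.differentiable (by simp) x) (hg.differentiable (by simp) x)]
  rfl

theorem dirDeriv_const_smul {f : E → ℝ} (hf : ContDiff ℝ ∞ f) (c : ℝ) (y : E) :
    dirDeriv y (c • f) = c • dirDeriv y f := by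
  funext x
  simp only [dirDeriv, Pi.smul_apply]
  rw [fderiv_const_smul (hf.differentiable (by simp) x)]
  rfl

theorem dirDeriv_comm {f : E → ℝ} (hf : ContDiff ℝ ∞ f) (y z : E) :
    dirDeriv y (dirDeriv z f) = dirDeriv z (dirDeriv y f) := by
  funext x
  have hd : DifferentiableAt ℝ (fderiv ℝ f) x :=
    (hf.fderiv_right (m := ∞) le_rfl).differentiable (by simp) x
  have e : ∀ u v, dirDeriv u (dirDeriv v f) x = fderiv ℝ (fderiv ℝ f) x u v := by
    intro u v
    have h := hd.hasFDerivAt.clm_apply (hasFDerivAt_const v x)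
    have e1 : fderiv ℝ (dirDeriv v f) x = _ := h.fderiv
    rw [dirDeriv, e1]
    simp
  rw [e, e]
  exact (hf.contDiffAt.isSymmSndFDerivAt (by
    rw [minSmoothness_of_isRCLikeNormedField]
    exact ENat.LEInfty.out)) y z

theorem iteratedFDeriv_diag {f : E → ℝ} (hf : ContDiff ℝ ∞ f) (y : E) (k : ℕ) :
    ∀ x, iteratedFDeriv ℝ k f x (fun _ => y) = (dirDeriv y)^[k] f x := by
  have hsm : ∀ k, ContDiff ℝ ∞ ((dirDeriv y)^[k] f) := fun k => by
    induction k with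
    | zero => exact hf
    | succ k ih => rw [Function.iterate_succ_apply']; exact contDiff_dirDeriv ih y
  induction k with
  | zero => simp
  | succ k ih =>
    intro x
    have h1 := ContDiffAt.deriv_fderiv_add_smul (n := k) (f := f) (x := x) (y := y) (t := (0 : ℝ))
      (hf.contDiffAt.of_le (by exact_mod_cast le_top))
    rw [zero_smul, add_zero] at h1
    rw [← h1, Function.iterate_succ_apply']
    simp only [ih]
    have h2 := DifferentiableAt.deriv_comp_add_smul (x := x) (y := y) (t := (0 : ℝ))
      ((hsm k).differentiable (by simp) (x + (0 : ℝ) • y))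
    rw [h2, zero_smul, add_zero]
    rfl

/-- Order 4 suffices: the curve has norm at most |t|⁴ for |t| ≤ 1, so the error along it is O(t¹⁶).
-/
theorem exists_taylor_bound [FiniteDimensional ℝ E] {f : E → ℝ} (hf : ContDiff ℝ ∞ f) :
    ∃ C, ∀ y : E, ‖y‖ ≤ 1 → |f y - (f 0 + dirDeriv y f 0 + 1 / 2 * dirDeriv y (dirDeriv y f) 0
      + 1 / 6 * dirDeriv y (dirDeriv y (dirDeriv y f)) 0)| ≤ C * ‖y‖ ^ 4 := by
  have : ProperSpace E := FiniteDimensional.proper ℝ E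
  have hc : Continuous (iteratedFDeriv ℝ 4 f) := hf.continuous_iteratedFDeriv
    ENat.LEInfty.out
  obtain ⟨M, hM⟩ := (isCompact_closedBall (0 : E) 1).exists_bound_of_continuousOn hc.continuousOn
  -- The factor 1/6 = 1/3! belongs to the integral remainder; `M` bounds the fourth derivative on
  -- the unit ball.
  refine ⟨1 / 6 * M, fun y hy => ?_⟩
  have h := map_add_eq_sum_add_integral_iteratedFDeriv (f := f) (x := 0) (y := y) (n := 3)
    fun t _ => by exact_mod_cast (contDiff_infty.1 hf 4).contDiffAt
  have hI : ‖∫ t in (0 : ℝ)..1, (1 - t) ^ 3 • iteratedFDeriv ℝ (3 + 1) f ((0 : E) + t • y)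
      fun _ => y‖ ≤ M * ‖y‖ ^ 4 * |1 - 0| := by
    refine intervalIntegral.norm_integral_le_of_norm_le_const fun t ht => ?_
    rw [Set.uIoc_of_le zero_le_one] at ht
    have h1 : ‖(1 - t) ^ 3‖ ≤ 1 := by
      rw [norm_pow]
      refine pow_le_one₀ (norm_nonneg _) ?_
      rw [Real.norm_eq_abs, abs_le]
      constructor <;> linarith [ht.1, ht.2]
    have h2 : ‖iteratedFDeriv ℝ 4 f ((0 : E) + t • y) fun _ => y‖ ≤ M * ‖y‖ ^ 4 := by
      refine (ContinuousMultilinearMap.le_opNorm _ _).trans ?_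
      rw [Fin.prod_const]
      gcongr
      refine hM _ ?_
      rw [zero_add, mem_closedBall_zero_iff, norm_smul, Real.norm_of_nonneg ht.1.le]
      exact mul_le_one₀ ht.2 (norm_nonneg y) hy
    rw [norm_smul]
    calc _ ≤ 1 * (M * ‖y‖ ^ 4) := by gcongr
      _ = _ := one_mul _
  simp only [iteratedFDeriv_diag hf] at h hI
  rw [zero_add] at h
  rw [h]
  simp only [Finset.sum_range_succ, Finset.sum_range_zero, Function.iterate_zero_apply,
    Function.iterate_succ_apply', smul_eq_mul] at hI ⊢
  rw [sub_zero, abs_one, mul_one, Real.norm_eq_abs] at hI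
  norm_num [Nat.factorial] at hI ⊢
  linarith

end Directional

variable {n : ℕ} (hn : 2 ≤ n)

/-- The partial derivative with respect to `x_{a+1}`. -/
def pderiv (a : Fin 3) (f : Space n → ℝ) : Space n → ℝ :=
  dirDeriv (Pi.single (idx hn a) 1) f

theorem contDiff_pderiv {f : Space n → ℝ} (hf : ContDiff ℝ ∞ f) (a : Fin 3) :
    ContDiff ℝ ∞ (pderiv hn a f) := contDiff_dirDeriv hf _

theorem pderiv_comm {f : Space n → ℝ} (hf : ContDiff ℝ ∞ f) (a b : Fin 3) :
    pderiv hn a (pderiv hn b f) = pderiv hn b (pderiv hn a f) := dirDeriv_comm hf _ _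

theorem dirDeriv_curve (f : Space n → ℝ) (t : ℝ) : dirDeriv (curve hn t) f =
    t ^ 6 • pderiv hn 0 f + t ^ 5 • pderiv hn 1 f + (-t ^ 4) • pderiv hn 2 f := by
  have h : curve hn t = t ^ 6 • (Pi.single (idx hn 0) 1 : Space n) +
      t ^ 5 • (Pi.single (idx hn 1) 1 : Space n) +
      (-t ^ 4) • (Pi.single (idx hn 2) 1 : Space n) := by
    simp only [curve, ← Pi.single_smul, smul_eq_mul, mul_one]
  funext x
  simp only [dirDeriv, pderiv, h, map_add, map_smul, Pi.add_apply, Pi.smul_apply]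

theorem norm_curve_le {t : ℝ} (ht : |t| ≤ 1) : ‖curve hn t‖ ≤ |t| ^ 4 := by
  refine (pi_norm_le_iff_of_nonneg (by positivity)).2 fun i => ?_
  rcases lt_or_ge i.val 3 with hi | hi
  · have h : ∀ a, ‖coord hn a (curve hn t)‖ ≤ |t| ^ 4 := by
      intro a
      fin_cases a
      · simpa [abs_pow] using pow_le_pow_of_le_one (abs_nonneg t) ht (show 4 ≤ 6 by norm_num)
      · simpa [abs_pow] using pow_le_pow_of_le_one (abs_nonneg t) ht (show 4 ≤ 5 by norm_num)
      · simp
    exact h ⟨i.val, hi⟩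
  · rw [curve_apply_of_three_le hn t hi, norm_zero]
    positivity

/-- The relations between the low order Taylor coefficients of a function vanishing on `W_8`. -/
theorem pderiv_relations {f : Space n → ℝ} (hf : ContDiff ℝ ∞ f) (hN : VanishesOn (W8 hn) f) :
    (f 0 = 0 ∧ pderiv hn 0 f 0 = 0 ∧ pderiv hn 1 f 0 = 0 ∧ pderiv hn 2 f 0 = 0) ∧
    (pderiv hn 2 (pderiv hn 2 f) 0 = 0 ∧ pderiv hn 1 (pderiv hn 2 f) 0 = 0 ∧
      pderiv hn 1 (pderiv hn 1 f) 0 = 2 * pderiv hn 0 (pderiv hn 2 f) 0 ∧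
      pderiv hn 0 (pderiv hn 1 f) 0 = 0) ∧
    3 * pderiv hn 0 (pderiv hn 0 f) 0 = pderiv hn 2 (pderiv hn 2 (pderiv hn 2 f)) 0 ∧
    pderiv hn 1 (pderiv hn 2 (pderiv hn 2 f)) 0 = 0 ∧
    pderiv hn 0 (pderiv hn 2 (pderiv hn 2 f)) 0 = pderiv hn 1 (pderiv hn 1 (pderiv hn 2 f)) 0 ∧
    pderiv hn 1 (pderiv hn 1 (pderiv hn 1 f)) 0 =
      6 * pderiv hn 0 (pderiv hn 1 (pderiv hn 2 f)) 0 := by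
  obtain ⟨C, hC⟩ := exists_taylor_bound hf
  have h1 := fun a => contDiff_pderiv hn hf a
  have h2 := fun a b => contDiff_pderiv hn (h1 a) b
  have hlin : ∀ (y : Space n) (a b c : ℝ) {u v w : Space n → ℝ}, ContDiff ℝ ∞ u → ContDiff ℝ ∞ v →
      ContDiff ℝ ∞ w → dirDeriv y (a • u + b • v + c • w) =
        a • dirDeriv y u + b • dirDeriv y v + c • dirDeriv y w := by
    intro y a b c u v w hu hv hw
    have ha : ContDiff ℝ ∞ (a • u) := hu.const_smul a
    have hb : ContDiff ℝ ∞ (b • v) := hv.const_smul b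
    have hc : ContDiff ℝ ∞ (c • w) := hw.const_smul c
    have hab : ContDiff ℝ ∞ (a • u + b • v) := ha.add hb
    rw [dirDeriv_add hab hc, dirDeriv_add ha hb, dirDeriv_const_smul hu, dirDeriv_const_smul hv,
      dirDeriv_const_smul hw]
  have hsm : ∀ (a b c : ℝ) {u v w : Space n → ℝ}, ContDiff ℝ ∞ u → ContDiff ℝ ∞ v →
      ContDiff ℝ ∞ w → ContDiff ℝ ∞ (a • u + b • v + c • w) := fun a b c _ _ _ hu hv hw =>
    ((hu.const_smul a).add (hv.const_smul b)).add (hw.const_smul c)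
  have c2 : ∀ a b, pderiv hn a (pderiv hn b f) 0 = pderiv hn b (pderiv hn a f) 0 := fun a b => congrFun (pderiv_comm hn hf a b) 0
  have c3 : ∀ a b c, pderiv hn a (pderiv hn b (pderiv hn c f)) 0 = pderiv hn a (pderiv hn c (pderiv hn b f)) 0 := fun a b c => by rw [pderiv_comm hn hf b c]
  have c3' : ∀ a b c, pderiv hn a (pderiv hn b (pderiv hn c f)) 0 = pderiv hn b (pderiv hn a (pderiv hn c f)) 0 := fun a b c =>
    congrFun (pderiv_comm hn (h1 c) a b) 0
  have hz : ∀ᶠ t in 𝓝 (0 : ℝ), f (curve hn t) = 0 := by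
    have hc := (hasDerivAt_curve hn 0).continuousAt
    have h0 : curve hn 0 = 0 := by simp [curve]
    rw [ContinuousAt, h0] at hc
    filter_upwards [hc.eventually hN] with t ht using ht (curve_mem hn t)
  have hle : ∀ᶠ t in 𝓝 (0 : ℝ), |t| ≤ 1 := by
    filter_upwards [Metric.closedBall_mem_nhds (0 : ℝ) one_pos] with t ht
    simpa using ht
  -- The entries are the coefficients of t⁰, …, t¹⁵ in the cubic Taylor polynomial at (t⁶, t⁵, −t⁴);
  -- the minus sign of x_3 produces the signs. Coincidences of degree, such as x_2² and x_1x_3 at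
  -- t¹⁰, yield relations rather than vanishing.
  have key := coeff_eq_zero_of_bound 16
    ![f 0, 0, 0, 0, -pderiv hn 2 f 0, pderiv hn 1 f 0, pderiv hn 0 f 0, 0, pderiv hn 2 (pderiv hn 2 f) 0 / 2, -pderiv hn 1 (pderiv hn 2 f) 0, pderiv hn 1 (pderiv hn 1 f) 0 / 2 - pderiv hn 0 (pderiv hn 2 f) 0, pderiv hn 0 (pderiv hn 1 f) 0,
      pderiv hn 0 (pderiv hn 0 f) 0 / 2 - pderiv hn 2 (pderiv hn 2 (pderiv hn 2 f)) 0 / 6, pderiv hn 1 (pderiv hn 2 (pderiv hn 2 f)) 0 / 2, pderiv hn 0 (pderiv hn 2 (pderiv hn 2 f)) 0 / 2 - pderiv hn 1 (pderiv hn 1 (pderiv hn 2 f)) 0 / 2,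
      pderiv hn 1 (pderiv hn 1 (pderiv hn 1 f)) 0 / 6 - pderiv hn 0 (pderiv hn 1 (pderiv hn 2 f)) 0]
    -- The cubic monomials x_1³, x_1²x_2, x_1x_2², x_1²x_3 have degree at least 16 in t, so for |t|
    -- ≤ 1 they go into the constant.
    ⟨|C| + |pderiv hn 0 (pderiv hn 0 (pderiv hn 0 f)) 0 / 6| + |pderiv hn 0 (pderiv hn 0 (pderiv hn 1 f)) 0 / 2| + |pderiv hn 0 (pderiv hn 1 (pderiv hn 1 f)) 0 / 2 - pderiv hn 0 (pderiv hn 0 (pderiv hn 2 f)) 0 / 2|, by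
      filter_upwards [nhdsWithin_le_nhds hz, nhdsWithin_le_nhds hle] with t ht ht1
      have hn1 := norm_curve_le hn ht1
      have hb := hC (curve hn t) (hn1.trans (pow_le_one₀ (abs_nonneg t) ht1))
      rw [ht, zero_sub, abs_neg] at hb
      have hb' : C * ‖curve hn t‖ ^ 4 ≤ |C| * |t| ^ 16 := by
        calc _ ≤ |C| * ‖curve hn t‖ ^ 4 := by gcongr; exact le_abs_self C
          _ ≤ |C| * (|t| ^ 4) ^ 4 := by gcongr
          _ = _ := by rw [← pow_mul]
      have e1 := dirDeriv_curve hn f t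
      have e2 := congrArg (dirDeriv (curve hn t)) e1
      rw [hlin _ _ _ _ (h1 0) (h1 1) (h1 2)] at e2
      simp only [dirDeriv_curve hn (pderiv hn _ f) t] at e2
      have e3 := congrArg (dirDeriv (curve hn t)) e2
      rw [hlin _ _ _ _ (hsm _ _ _ (h2 0 0) (h2 0 1) (h2 0 2))
          (hsm _ _ _ (h2 1 0) (h2 1 1) (h2 1 2)) (hsm _ _ _ (h2 2 0) (h2 2 1) (h2 2 2)),
          hlin _ _ _ _ (h2 0 0) (h2 0 1) (h2 0 2), hlin _ _ _ _ (h2 1 0) (h2 1 1) (h2 1 2),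
          hlin _ _ _ _ (h2 2 0) (h2 2 1) (h2 2 2)] at e3
      simp only [dirDeriv_curve hn (pderiv hn _ (pderiv hn _ f)) t] at e3
      rw [e3, e2, e1] at hb
      simp only [Pi.add_apply, Pi.smul_apply, smul_eq_mul] at hb
      simp only [c2 1 0, c2 2 0, c2 2 1, c3 _ 1 0, c3 _ 2 0, c3 _ 2 1, c3' 1 0, c3' 2 0,
        c3' 2 1] at hb
      have hb2 := hb.trans hb'
      clear hb
      generalize pderiv hn 0 (pderiv hn 0 (pderiv hn 0 f)) 0 = d000 at *
      generalize pderiv hn 0 (pderiv hn 0 (pderiv hn 1 f)) 0 = d001 at *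
      generalize pderiv hn 0 (pderiv hn 1 (pderiv hn 1 f)) 0 = d011 at *
      generalize pderiv hn 0 (pderiv hn 0 (pderiv hn 2 f)) 0 = d002 at *
      simp [Fin.sum_univ_succ]
      have hG : |t ^ 16 * (t ^ 2 * (d000 / 6) + t * (d001 / 2) + (d011 / 2 - d002 / 2))| ≤
          |t| ^ 16 * (|d000 / 6| + |d001 / 2| + |d011 / 2 - d002 / 2|) := by
        rw [abs_mul, abs_pow]
        gcongr
        refine (abs_add_three _ _ _).trans ?_
        rw [abs_mul, abs_mul, abs_pow]
        gcongr
        · exact mul_le_of_le_one_left (abs_nonneg _) (pow_le_one₀ (abs_nonneg t) ht1)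
        · exact mul_le_of_le_one_left (abs_nonneg _) ht1
      obtain ⟨l1, u1⟩ := abs_le.1 hb2
      obtain ⟨l2, u2⟩ := abs_le.1 hG
      rw [abs_le]
      constructor <;> linarith⟩
  have k4 := key 4
  have k5 := key 5
  have k6 := key 6
  have k8 := key 8
  have k9 := key 9
  have k10 := key 10
  have k11 := key 11
  have k12 := key 12
  have k13 := key 13
  have k14 := key 14
  have k15 := key 15
  simp at k4 k5 k6 k8 k9 k10 k11 k12 k13 k14 k15
  refine ⟨⟨by simpa using key 0, k6, k5, k4⟩, ⟨k8, k9, by linarith, k11⟩, by linarith, k13,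
    by linarith, by linarith⟩

end

/-! ### Linear independence of the eight restrictions. -/

section

variable {n : ℕ} (hn : 2 ≤ n)

theorem pderiv_congr {f g : Space n → ℝ} (h : f =ᶠ[𝓝 0] g) (a : Fin 3) :
    pderiv hn a f =ᶠ[𝓝 0] pderiv hn a g := dirDeriv_congr h _

/-- These polynomials contain every monomial that occurs in a component of Σ c_j θ_j. -/
theorem pderiv_coord_affine (a : Fin 3) (c d₀ d₁ d₂ q₁ q₂ : ℝ) :
    pderiv hn a (fun x => c + d₀ * coord hn 0 x + d₁ * coord hn 1 x + d₂ * coord hn 2 x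
      + q₁ * coord hn 1 x ^ 2 + q₂ * coord hn 2 x ^ 2) =
    (![fun _ => d₀, fun x => d₁ + 2 * q₁ * coord hn 1 x, fun x => d₂ + 2 * q₂ * coord hn 2 x] :
      Fin 3 → Space n → ℝ) a := by
  funext x
  have h0 := hasFDerivAt_coord hn 0 x
  have h1 := hasFDerivAt_coord hn 1 x
  have h2 := hasFDerivAt_coord hn 2 x
  have h := (((((hasFDerivAt_const c x).add (h0.const_mul d₀)).add (h1.const_mul d₁)).add
    (h2.const_mul d₂)).add ((h1.pow 2).const_mul q₁)).add ((h2.pow 2).const_mul q₂)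
  have e := h.fderiv
  rw [pderiv, dirDeriv]
  refine (congrArg (fun T : Space n →L[ℝ] ℝ => T (Pi.single (idx hn a) 1)) e).trans ?_
  have hs : ∀ a b, (Pi.single (idx hn a) (1 : ℝ) : Space n) (idx hn b) = if b = a then 1 else 0 :=
    fun a b => by simp [Pi.single_apply, (idx_injective hn).eq_iff]
  fin_cases a <;> simp [hs] <;> try ring

/-- The component of the form `β` along `dx_{a+1}`. -/
def comp₁ (β : FormField (Space n) 1) (a : Fin 3) (x : Space n) : ℝ :=
  β x ![Pi.single (idx hn a) 1]

/-- The component of the form `α` along `dx_{a+1} ∧ dx_{b+1}`. -/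
def comp₂ (α : FormField (Space n) 2) (a b : Fin 3) (x : Space n) : ℝ :=
  α x ![Pi.single (idx hn a) 1, Pi.single (idx hn b) 1]

theorem contDiff_form_apply {k : ℕ} {β : FormField (Space n) k} (hβ : ContDiff ℝ ∞ β)
    (v : Fin k → Space n) : ContDiff ℝ ∞ fun x => β x v :=
  (ContinuousAlternatingMap.apply ℝ (Space n) ℝ v).contDiff.comp hβ

theorem comp₂_extDeriv {β : FormField (Space n) 1} (hβ : ContDiff ℝ ∞ β) (a b : Fin 3) :
    comp₂ hn (extDeriv β) a b = pderiv hn a (comp₁ hn β b) - pderiv hn b (comp₁ hn β a) := by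
  funext x
  have hd := hβ.differentiable (by simp) x
  rw [comp₂, extDeriv_one_apply, ← hasFDerivAt_form_apply hd, ← hasFDerivAt_form_apply hd]
  rfl

theorem linearIndependent_theta :
    LinearIndependent ℝ fun j => algRestriction (W8 hn) (theta hn j) := by
  rw [Fintype.linearIndependent_iff]
  intro c hc
  have hmem : ∑ j, c j • theta hn j ∈ zeroRestriction (W8 hn) 1 := by
    rw [← (zeroRestriction (W8 hn) 1).ker_mkQ, LinearMap.mem_ker, map_sum]
    simpa using hc
  obtain ⟨α', β', hα', hβ', hαN', hβN', h'⟩ := hmem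
  obtain ⟨α, hα, hαα'⟩ := hα'.exists_contDiff
  obtain ⟨β, hβ, hββ'⟩ := hβ'.exists_contDiff
  have hαN : ∀ a b, VanishesOn (W8 hn) (comp₂ hn α a b) := fun a b => by
    filter_upwards [hαN', hαα'] with x h1 h2 hx
    simp [comp₂, h2, h1 hx]
  have hβN : ∀ a, VanishesOn (W8 hn) (comp₁ hn β a) := fun a => by
    filter_upwards [hβN', hββ'] with x h1 h2 hx
    simp [comp₁, h2, h1 hx]
  have h : (fun x => ∑ j, c j • thetaField hn j x) =ᶠ[𝓝 0] fun x => α x + extDeriv β x := by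
    filter_upwards [h', hαα', hββ'.extDeriv] with x h1 h2 h3
    rw [h2, h3, ← h1]
    simp [theta]
  have hcomp : ∀ a b, (fun x => ∑ j, c j * thetaField hn j x
      ![Pi.single (idx hn a) 1, Pi.single (idx hn b) 1]) =ᶠ[𝓝 0] comp₂ hn α a b +
        (pderiv hn a (comp₁ hn β b) - pderiv hn b (comp₁ hn β a)) := fun a b => by
    rw [← comp₂_extDeriv hn hβ]
    filter_upwards [h] with x hx
    have := congrArg (fun T : Space n [⋀^Fin 2]→L[ℝ] ℝ =>
      T ![Pi.single (idx hn a) 1, Pi.single (idx hn b) 1]) hx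
    simpa [comp₂] using this
  have sα : ∀ a b, ContDiff ℝ ∞ (comp₂ hn α a b) := fun a b => contDiff_form_apply hα _
  have sβ : ∀ a, ContDiff ℝ ∞ (comp₁ hn β a) := fun a => contDiff_form_apply hβ _
  have hA := hcomp 1 2
  have hB := hcomp 0 2
  have hC := hcomp 0 1
  have eA : (fun x => ∑ j, c j * thetaField hn j x
      ![Pi.single (idx hn 1) 1, Pi.single (idx hn 2) 1]) = fun x => c 0 + c 5 * coord hn 0 x +
        c 4 * coord hn 1 x + c 3 * coord hn 2 x + c 7 * coord hn 1 x ^ 2 +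
        c 6 * coord hn 2 x ^ 2 := by
    funext x
    simp only [thetaField_eq, Fin.sum_univ_eight]
    simp [thetaCoef]
    ring
  have eB : (fun x => ∑ j, c j * thetaField hn j x
      ![Pi.single (idx hn 0) 1, Pi.single (idx hn 2) 1]) = fun x => c 1 + 0 * coord hn 0 x +
        c 5 * coord hn 1 x + 0 * coord hn 2 x + 0 * coord hn 1 x ^ 2 +
        0 * coord hn 2 x ^ 2 := by
    funext x
    simp only [thetaField_eq, Fin.sum_univ_eight]
    simp [thetaCoef]
  have eC : (fun x => ∑ j, c j * thetaField hn j x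
      ![Pi.single (idx hn 0) 1, Pi.single (idx hn 1) 1]) = fun x => c 2 + 0 * coord hn 0 x +
        0 * coord hn 1 x + 0 * coord hn 2 x + 0 * coord hn 1 x ^ 2 +
        0 * coord hn 2 x ^ 2 := by
    funext x
    simp only [thetaField_eq, Fin.sum_univ_eight]
    simp [thetaCoef]
  rw [eA] at hA
  rw [eB] at hB
  rw [eC] at hC
  have first : ∀ {f : Space n → ℝ} (a b : Fin 3),
      f =ᶠ[𝓝 0] comp₂ hn α a b + (pderiv hn a (comp₁ hn β b) - pderiv hn b (comp₁ hn β a)) →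
      ∀ d, pderiv hn d f =ᶠ[𝓝 0] pderiv hn d (comp₂ hn α a b) +
        (pderiv hn d (pderiv hn a (comp₁ hn β b)) - pderiv hn d (pderiv hn b (comp₁ hn β a))) := by
    intro f a b hf d
    have e := pderiv_congr hn hf d
    have s1 := contDiff_pderiv hn (sβ b) a
    have s2 := contDiff_pderiv hn (sβ a) b
    have s12 : ContDiff ℝ ∞ (pderiv hn a (comp₁ hn β b) - pderiv hn b (comp₁ hn β a)) :=
      s1.sub s2
    have e2 : pderiv hn d (comp₂ hn α a b + (pderiv hn a (comp₁ hn β b) -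
      pderiv hn b (comp₁ hn β a))) = pderiv hn d (comp₂ hn α a b) +
        pderiv hn d (pderiv hn a (comp₁ hn β b) - pderiv hn b (comp₁ hn β a)) :=
      dirDeriv_add (sα a b) s12 _
    have e3 : pderiv hn d (pderiv hn a (comp₁ hn β b) - pderiv hn b (comp₁ hn β a)) =
      pderiv hn d (pderiv hn a (comp₁ hn β b)) - pderiv hn d (pderiv hn b (comp₁ hn β a)) :=
      dirDeriv_sub s1 s2 _
    rw [e2, e3] at e
    exact e
  have second : ∀ {f : Space n → ℝ} (a b : Fin 3),
      f =ᶠ[𝓝 0] comp₂ hn α a b + (pderiv hn a (comp₁ hn β b) - pderiv hn b (comp₁ hn β a)) →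
      ∀ d e, pderiv hn e (pderiv hn d f) 0 = pderiv hn e (pderiv hn d (comp₂ hn α a b)) 0 +
        (pderiv hn e (pderiv hn d (pderiv hn a (comp₁ hn β b))) 0 -
          pderiv hn e (pderiv hn d (pderiv hn b (comp₁ hn β a))) 0) := by
    intro f a b hf d e
    have h1 := (pderiv_congr hn (first a b hf d) e).self_of_nhds
    have s1 := contDiff_pderiv hn (contDiff_pderiv hn (sβ b) a) d
    have s2 := contDiff_pderiv hn (contDiff_pderiv hn (sβ a) b) d
    have s12 : ContDiff ℝ ∞ (pderiv hn d (pderiv hn a (comp₁ hn β b)) -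
        pderiv hn d (pderiv hn b (comp₁ hn β a))) := s1.sub s2
    have e2 := congrFun (dirDeriv_add (contDiff_pderiv hn (sα a b) d) s12
      (Pi.single (idx hn e) 1)) 0
    have e3 := congrFun (dirDeriv_sub s1 s2 (Pi.single (idx hn e) 1)) 0
    exact h1.trans (e2.trans (congrArg _ e3))
  have rα := fun a b => pderiv_relations hn (sα a b) (hαN a b)
  have rβ := fun a => pderiv_relations hn (sβ a) (hβN a)
  have cm2 := fun a d e => congrFun (pderiv_comm hn (sβ a) d e) 0
  have cm3 : ∀ a d e f, pderiv hn d (pderiv hn e (pderiv hn f (comp₁ hn β a))) 0 =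
      pderiv hn d (pderiv hn f (pderiv hn e (comp₁ hn β a))) 0 := fun a d e f => by
    rw [pderiv_comm hn (sβ a) e f]
  have cm3' : ∀ a d e f, pderiv hn d (pderiv hn e (pderiv hn f (comp₁ hn β a))) 0 =
      pderiv hn e (pderiv hn d (pderiv hn f (comp₁ hn β a))) 0 := fun a d e f =>
    congrFun (pderiv_comm hn (contDiff_pderiv hn (sβ a) f) d e) 0
  have zA := hA.self_of_nhds
  have zB := hB.self_of_nhds
  have zC := hC.self_of_nhds
  have fA := fun d => (first 1 2 hA d).self_of_nhds
  have fB := fun d => (first 0 2 hB d).self_of_nhds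
  have fC := fun d => (first 0 1 hC d).self_of_nhds
  have gA := second 1 2 hA
  have gB := second 0 2 hB
  have gC := second 0 1 hC
  simp only [pderiv_coord_affine] at fA fB fC gA gB gC
  have cst : ∀ (a : Fin 3) (r : ℝ), pderiv hn a (fun _ => r) 0 = 0 := fun a r => by
    simp [pderiv, dirDeriv]
  have lin : ∀ (a b : Fin 3) (r s : ℝ), pderiv hn a (fun x => r + s * coord hn b x) 0 =
      if a = b then s else 0 := by
    intro a b r s
    have h := ((hasFDerivAt_coord hn b 0).const_mul s).const_add r
    rw [pderiv, dirDeriv, h.fderiv]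
    simp [Pi.single_apply, (idx_injective hn).eq_iff, eq_comm]
  have fA0 := fA 0
  have fA1 := fA 1
  have fA2 := fA 2
  have fB1 := fB 1
  have fB2 := fB 2
  have fC0 := fC 0
  have gA11 := gA 1 1
  have gA22 := gA 2 2
  have gA20 := gA 2 0
  have gB21 := gB 2 1
  have gC22 := gC 2 2
  simp [lin, cst] at zA zB zC fA0 fA1 fA2 fB1 fB2 fC0 gA11 gA22 gA20 gB21 gC22
  obtain ⟨⟨a00, a01, a02, a03⟩, ⟨a04, a05, a06, a07⟩, -⟩ := rα 1 2
  obtain ⟨⟨b00, b01, b02, b03⟩, ⟨b04, b05, b06, b07⟩, -⟩ := rα 0 2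
  obtain ⟨⟨d00, d01, d02, d03⟩, ⟨d04, d05, d06, d07⟩, -⟩ := rα 0 1
  obtain ⟨⟨x00, x01, x02, x03⟩, ⟨x04, x05, x06, x07⟩, x08, x09, x10, x11⟩ := rβ 0
  obtain ⟨⟨y00, y01, y02, y03⟩, ⟨y04, y05, y06, y07⟩, y08, y09, y10, y11⟩ := rβ 1
  obtain ⟨⟨z00, z01, z02, z03⟩, ⟨z04, z05, z06, z07⟩, z08, z09, z10, z11⟩ := rβ 2
  -- Mixed derivatives are put in increasing order of index, so that `linarith` identifies equal
  -- ones.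
  simp only [cm2 _ 1 0, cm2 _ 2 0, cm2 _ 2 1, cm3 _ _ 2 0, cm3 _ _ 2 1, cm3' _ 1 0,
    cm3' _ 2 0, cm3' _ 2 1] at *
  have k0 : c 0 = 0 := by linarith
  have k1 : c 1 = 0 := by linarith
  have k2 : c 2 = 0 := by linarith
  have k3 : c 3 = 0 := by linarith
  -- `fA1` gives c₄ = ∂₁²β₂ = 2∂₀∂₂β₂, which is 0 by `fB2`.
  have k4 : c 4 = 0 := by linarith
  -- In `fB1` both mixed derivatives, ∂₀∂₁β₂ and ∂₁∂₂β₀, vanish.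
  have k5 : c 5 = 0 := by linarith
  -- `gA22` gives 2c₆ = −∂₂³β₁ = −3∂₀²β₁, which is 0 by `fC0`.
  have k6 : c 6 = 0 := by linarith
  -- `gA11` gives 2c₇ = 2∂₀∂₂α₁₂ + 6∂₀∂₁∂₂β₂ − ∂₀∂₂²β₁. The last two terms vanish by `gB21` and
  -- `gC22`, and then the first by `gA20`.
  have k7 : c 7 = 0 := by linarith
  intro j
  fin_cases j <;> assumption

/-- The products of the relation coefficients and the weights form the table of the action. -/
theorem relCoef_mul_weight_smul {M : Type*} [AddCommGroup M] [Module ℝ M]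
    (θ₁ θ₂ θ₃ θ₄ θ₅ θ₆ θ₇ θ₈ : M) (i j : Fin 8) :
    (relCoef i j * weight (relIdx i j)) • ![θ₁, θ₂, θ₃, θ₄, θ₅, θ₆, θ₇, θ₈] (relIdx i j) =
      (![![(9 : ℝ) • θ₁, (10 : ℝ) • θ₂, (11 : ℝ) • θ₃, (13 : ℝ) • θ₄,
              (14 : ℝ) • θ₅, (15 : ℝ) • θ₆, (17 : ℝ) • θ₇, (19 : ℝ) • θ₈],
            ![(13 : ℝ) • θ₄, (-28 : ℝ) • θ₅, (5 : ℝ) • θ₆, (17 : ℝ) • θ₇,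
              0, (-57 : ℝ) • θ₈, 0, 0],
            ![(14 : ℝ) • θ₅, (10 : ℝ) • θ₆, 0, 0, (19 : ℝ) • θ₈, 0, 0, 0],
            ![(5 : ℝ) • θ₆, 0, (51 / 2 : ℝ) • θ₇, (-19 : ℝ) • θ₈, 0, 0, 0, 0],
            ![(17 : ℝ) • θ₇, 0, (-19 : ℝ) • θ₈, 0, 0, 0, 0, 0],
            ![0, (-38 : ℝ) • θ₈, 0, 0, 0, 0, 0, 0],
            ![(19 : ℝ) • θ₈, 0, 0, 0, 0, 0, 0, 0],
            ![(-19 : ℝ) • θ₈, 0, 0, 0, 0, 0, 0, 0]] : Fin 8 → Fin 8 → M) i j := by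
  fin_cases i <;> fin_cases j <;> simp [relCoef, weight, relIdx] <;> norm_num

end

end AlgRestrW8

end

/-! ### Assembly of the basis, the tangency and the table. -/

theorem mainTheorem11 {n : ℕ} (hn : 2 ≤ n)
    (θ₁ θ₂ θ₃ θ₄ θ₅ θ₆ θ₇ θ₈ : AlgRestrW8.AlgRestriction (AlgRestrW8.W8 hn) 1)
    -- `θ₁, …, θ₈` denote the algebraic restrictions to `W_8` of the eight `2`-forms
    (hθ : ∀ j : Fin 8, ![θ₁, θ₂, θ₃, θ₄, θ₅, θ₆, θ₇, θ₈] j =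
      AlgRestrW8.algRestriction (AlgRestrW8.W8 hn) (AlgRestrW8.theta hn j)) :
    -- they form a basis of the space of algebraic restrictions to `W_8` of closed `2`-forms
    LinearIndependent ℝ ![θ₁, θ₂, θ₃, θ₄, θ₅, θ₆, θ₇, θ₈] ∧
    Submodule.span ℝ (Set.range ![θ₁, θ₂, θ₃, θ₄, θ₅, θ₆, θ₇, θ₈]) =
      AlgRestrW8.closedRestrictions (AlgRestrW8.W8 hn) 1 ∧
    -- the vector fields `X_0, …, X_7` are tangent to `W_8`
    (∀ i : Fin 8, AlgRestrW8.IsTangentTo (AlgRestrW8.vectorField hn i) (AlgRestrW8.W8 hn)) ∧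
    -- their Lie derivatives act on algebraic restrictions, and the action is given by the table
    ∃ L : Fin 8 → Module.End ℝ (AlgRestrW8.AlgRestriction (AlgRestrW8.W8 hn) 1),
      (∀ (i : Fin 8) (η : AlgRestrW8.smoothForms (AlgRestrW8.Space n) 2),
        L i (AlgRestrW8.algRestriction (AlgRestrW8.W8 hn) η) =
          AlgRestrW8.algRestriction (AlgRestrW8.W8 hn)
            (AlgRestrW8.lieDeriv (AlgRestrW8.vectorField hn i) η)) ∧
      ∀ i j : Fin 8, L i (![θ₁, θ₂, θ₃, θ₄, θ₅, θ₆, θ₇, θ₈] j) =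
        (![![(9 : ℝ) • θ₁, (10 : ℝ) • θ₂, (11 : ℝ) • θ₃, (13 : ℝ) • θ₄,
              (14 : ℝ) • θ₅, (15 : ℝ) • θ₆, (17 : ℝ) • θ₇, (19 : ℝ) • θ₈],
            ![(13 : ℝ) • θ₄, (-28 : ℝ) • θ₅, (5 : ℝ) • θ₆, (17 : ℝ) • θ₇,
              0, (-57 : ℝ) • θ₈, 0, 0],
            ![(14 : ℝ) • θ₅, (10 : ℝ) • θ₆, 0, 0, (19 : ℝ) • θ₈, 0, 0, 0],
            ![(5 : ℝ) • θ₆, 0, (51 / 2 : ℝ) • θ₇, (-19 : ℝ) • θ₈, 0, 0, 0, 0],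
            ![(17 : ℝ) • θ₇, 0, (-19 : ℝ) • θ₈, 0, 0, 0, 0, 0],
            ![0, (-38 : ℝ) • θ₈, 0, 0, 0, 0, 0, 0],
            ![(19 : ℝ) • θ₈, 0, 0, 0, 0, 0, 0, 0],
            ![(-19 : ℝ) • θ₈, 0, 0, 0, 0, 0, 0, 0]] :
          Fin 8 → Fin 8 → AlgRestrW8.AlgRestriction (AlgRestrW8.W8 hn) 1) i j := by
  have hv : ![θ₁, θ₂, θ₃, θ₄, θ₅, θ₆, θ₇, θ₈] =
      fun j => AlgRestrW8.algRestriction (AlgRestrW8.W8 hn) (AlgRestrW8.theta hn j) := funext hθ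
  refine ⟨?_, ?_, AlgRestrW8.isTangentTo_vectorField hn, AlgRestrW8.lieEnd hn,
    AlgRestrW8.lieEnd_algRestriction hn, fun i j => ?_⟩
  · rw [hv]
    exact AlgRestrW8.linearIndependent_theta hn
  · rw [hv]
    exact AlgRestrW8.thetaSpan_eq hn
  · rw [hθ j, AlgRestrW8.lieEnd_algRestriction, AlgRestrW8.algRestriction_lieDeriv_theta, ← hθ]
    exact AlgRestrW8.relCoef_mul_weight_smul θ₁ θ₂ θ₃ θ₄ θ₅ θ₆ θ₇ θ₈ i j
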